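/- **Lemma 3.2 (a Jost–Pais identity).** Let $q\in\mathcal S(\mathbb R)$ be a complex-valued Schwartz function and let $k\in\mathbb C^+=\{k\in\mathbb C:\operatorname{Im}k>0\}$. On $L^2(\mathbb R)$ define the bounded operators $$\Lambda(k;q)=\bigl(\tfrac1i k-\partial\bigr)^{-\frac12}\,q\,\bigl(\tfrac1i k+\partial\bigr)^{-\frac12},\qquad \Gamma(k;q)=\bigl(\tfrac1i k+\partial\bigr)^{-\frac12}\,\bar q\,\bigl(\tfrac1i k-\partial\bigr)^{-\frac12},$$ where $q,\bar q$ act by multiplication and $\bigl(\tfrac1i k\pm\partial\bigr)^{-1/2}$ is the Fourier multiplier with symbol $(-ik\pm i\xi)^{-1/2}$ (principal branch; the base has real part $\operatorname{Im}k>0$, and $\partial$ has symbol $i\xi$). Let $\sqrt k$ denote the square root of $k$ in the open first quadrant. For $\lambda=\sqrt k$ consider the Kaup–Newell system $$\psi'=\begin{bmatrix}-i\lambda^2&\lambda q\\-\lambda\bar q&i\lambda^2\end{bmatrix}\psi,\qquad \psi:\mathbb R\to\mathbb C^2 .$$ It has exactly one solution $\Psi_1^-=(\Psi_{11}^-,\Psi_{21}^-)$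 on $\mathbb R$ (the first column of the Jost solution at $-\infty$) with $\lim_{x\to-\infty}e^{i\lambda^2x}\Psi^-_1(x)=(1,0)$, and the limit $$\mathtt a(\lambda;q):=\lim_{x\to+\infty}e^{i\lambda^2x}\,\Psi^-_{11}(x)$$ exists. Moreover, $k\Lambda(k;q)\Gamma(k;q)$ is trace class, and its Fredholm determinant satisfies $$\det\bigl[1-k\Lambda(k;q)\Gamma(k;q)\bigr]=\mathtt a(\sqrt k;q).$$ Here, for trace class $T$, $\det(1+T)=\sum_{n\ge0}\operatorname{tr}(\textstyle\bigwedge^nT)$; that is, in any orthonormal basis $(e_i)$ of $L^2(\mathbb R)$, $\det(1+T)$ is the unconditionally convergent sum over all finite index sets $s$ of the minors $\det[\langle e_i,Te_j\rangle]_{i,j\in s}$, the empty minor being $1$. -/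

import Mathlib

open MeasureTheory Filter Topology
open scoped ENNReal SchwartzMap ComplexConjugate

noncomputable section

/-! ## Trace class operators and Fredholm determinants on a complex Hilbert space -/

section Fredholm

universe u

/-- `T` is trace class (nuclear): `T = ∑ₙ ⟨xₙ, ·⟩ yₙ` with `∑ₙ ‖xₙ‖ ‖yₙ‖ < ∞`. -/
def IsTraceClass {E : Type u} [NormedAddCommGroup E] [InnerProductSpace ℂ E]
    (T : E →L[ℂ] E) : Prop :=
  ∃ x y : ℕ → E, Summable (fun n => ‖x n‖ * ‖y n‖) ∧
    ∀ f : E, HasSum (fun n => inner ℂ (x n) f • y n) (T f)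

/-- The principal minor `det [⟨bᵢ, T bⱼ⟩]_{i,j ∈ s}` of the matrix of `T` in the Hilbert basis `b`.
The empty minor is `1`. -/
def principalMinor {E : Type u} [NormedAddCommGroup E] [InnerProductSpace ℂ E]
    {ι : Type u} (b : HilbertBasis ι ℂ E) (T : E →L[ℂ] E) (s : Finset ι) : ℂ :=
  open Classical in
  Matrix.det (Matrix.of fun i j : s => inner ℂ (b i) (T (b j)))

/-- `T` is trace class and `det (1 + T) = d`, the Fredholm determinant being
`det (1 + T) = ∑ₙ tr (⋀ⁿ T)`. In a Hilbert basis `b` the space `⋀ⁿ E` has the orthonormal basis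
`b_{i₁} ∧ ⋯ ∧ b_{iₙ}`, `i₁ < ⋯ < iₙ`, so `tr (⋀ⁿ T)` is the sum of all principal minors of size
`n`, and `det (1 + T)` is the (unconditionally convergent) sum of all finite principal minors.
Convergence to the same value `d` is required in every Hilbert basis. -/
def HasFredholmDet {E : Type u} [NormedAddCommGroup E] [InnerProductSpace ℂ E]
    (T : E →L[ℂ] E) (d : ℂ) : Prop :=
  IsTraceClass T ∧
    ∀ (ι : Type u) (b : HilbertBasis ι ℂ E), HasSum (principalMinor b T) d

end Fredholm

/-! ## The operators `Λ(k; q)` and `Γ(k; q)` on `L²(ℝ)` -/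

/-- The Hilbert space `L²(ℝ; ℂ)`. -/
abbrev L2R : Type := Lp ℂ 2 (volume : Measure ℝ)

/-- Multiplication by the essentially bounded function `m`, as a bounded operator on `L²(ℝ)`. -/
def mulOp (m : ℝ → ℂ) (hm : MemLp m ∞ (volume : Measure ℝ)) : L2R →L[ℂ] L2R :=
  (ContinuousLinearMap.mul ℂ ℂ).holderL (volume : Measure ℝ) ∞ 2 2 (hm.toLp m)

/-- The Fourier multiplier `𝓕⁻¹ m 𝓕` on `L²(ℝ)`. Here `𝓕 f (ξ) = ∫ exp (-2πixξ) f(x) dx`, so that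
the derivative `∂` has symbol `2πiξ`. -/
def fourierMul (m : ℝ → ℂ) (hm : MemLp m ∞ (volume : Measure ℝ)) : L2R →L[ℂ] L2R :=
  ((Lp.fourierTransformₗᵢ ℝ ℂ).symm : L2R ≃L[ℂ] L2R).toContinuousLinearMap ∘L mulOp m hm ∘L
    ((Lp.fourierTransformₗᵢ ℝ ℂ) : L2R ≃L[ℂ] L2R).toContinuousLinearMap

/-- The symbol `(-ik + σ · 2πiξ)^(-1/2)` (principal branch) of `(k/i + σ ∂)^(-1/2)`; only `σ = ±1`
is used. If `Im k > 0`, the base has real part `Im k > 0`. -/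
def halfSymbol (k : ℂ) (σ : ℝ) (ξ : ℝ) : ℂ :=
  (k / Complex.I + (σ : ℂ) * (2 * (Real.pi : ℂ) * Complex.I * (ξ : ℂ))) ^ (-(1 / 2) : ℂ)

lemma halfSymbol_base_re (k : ℂ) (σ ξ : ℝ) :
    (k / Complex.I + (σ : ℂ) * (2 * (Real.pi : ℂ) * Complex.I * (ξ : ℂ))).re = k.im := by
  simp [Complex.div_I]

lemma memLp_halfSymbol {k : ℂ} (hk : 0 < k.im) (σ : ℝ) :
    MemLp (halfSymbol k σ) ∞ (volume : Measure ℝ) := by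
  refine memLp_top_of_bound ?_ (k.im ^ (-(1 / 2) : ℝ)) (Eventually.of_forall fun ξ => ?_)
  · refine Continuous.aestronglyMeasurable ?_
    unfold halfSymbol
    refine Continuous.cpow (by fun_prop) continuous_const fun ξ => Or.inl ?_
    rw [halfSymbol_base_re]
    exact hk
  · have h0 : k.im ≤ ‖k / Complex.I + (σ : ℂ) * (2 * (Real.pi : ℂ) * Complex.I * (ξ : ℂ))‖ := by
      refine le_trans (le_of_eq (halfSymbol_base_re k σ ξ).symm) (Complex.re_le_norm _)
    have h1 : (-(1 / 2) : ℂ) = ((-(1 / 2) : ℝ) : ℂ) := by push_cast; rfl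
    rw [halfSymbol, h1, Complex.norm_cpow_real]
    exact Real.rpow_le_rpow_of_nonpos hk h0 (by norm_num)

/-- The bounded operator `(k/i + σ ∂)^(-1/2)` on `L²(ℝ)`, for `Im k > 0` and `σ = ±1`. -/
def halfResolvent (k : ℂ) (hk : 0 < k.im) (σ : ℝ) : L2R →L[ℂ] L2R :=
  fourierMul (halfSymbol k σ) (memLp_halfSymbol hk σ)

lemma memLp_conj_schwartz (q : 𝓢(ℝ, ℂ)) :
    MemLp (fun x => conj (q x)) ∞ (volume : Measure ℝ) :=
  (q.memLp ∞ volume).star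

/-- `Λ(k; q) = (k/i - ∂)^(-1/2) q (k/i + ∂)^(-1/2)`. -/
def LambdaOp (k : ℂ) (hk : 0 < k.im) (q : 𝓢(ℝ, ℂ)) : L2R →L[ℂ] L2R :=
  halfResolvent k hk (-1) ∘L mulOp q (q.memLp ∞ volume) ∘L halfResolvent k hk 1

/-- `Γ(k; q) = (k/i + ∂)^(-1/2) q̄ (k/i - ∂)^(-1/2)`. -/
def GammaOp (k : ℂ) (hk : 0 < k.im) (q : 𝓢(ℝ, ℂ)) : L2R →L[ℂ] L2R :=
  halfResolvent k hk 1 ∘L mulOp (fun x => conj (q x)) (memLp_conj_schwartz q) ∘L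
    halfResolvent k hk (-1)

/-! ## The Kaup–Newell system and the scattering coefficient -/

/-- `ψ` solves the Kaup–Newell system
`ψ' = -i σ₃ lam² ψ + lam [[0, q], [-q̄, 0]] ψ` on the whole line. -/
def SolvesKaupNewell (lam : ℂ) (q : 𝓢(ℝ, ℂ)) (ψ : ℝ → Fin 2 → ℂ) : Prop :=
  ∀ x : ℝ, HasDerivAt ψ
    (Matrix.mulVec !![-Complex.I * lam ^ 2, lam * q x; -lam * conj (q x), Complex.I * lam ^ 2]
      (ψ x)) x

/-- `ψ` is the first column `Ψ₁⁻` of the Jost solution normalized at `-∞`: it solves the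
Kaup–Newell system and `exp (i lam² x) ψ(x) → (1, 0)` as `x → -∞`. -/
def IsJostSolution (lam : ℂ) (q : 𝓢(ℝ, ℂ)) (ψ : ℝ → Fin 2 → ℂ) : Prop :=
  SolvesKaupNewell lam q ψ ∧
    Tendsto (fun x : ℝ => Complex.exp (Complex.I * lam ^ 2 * x) • ψ x) atBot (𝓝 ![1, 0])

/-- The Jost solution `Ψ₁⁻` exists, is unique, and the scattering coefficient
`lim_{x → +∞} exp (i lam² x) Ψ₁₁⁻(x)` exists and equals `a`. -/
def HasScatteringCoeff (lam : ℂ) (q : 𝓢(ℝ, ℂ)) (a : ℂ) : Prop :=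
  ∃ ψ : ℝ → Fin 2 → ℂ, IsJostSolution lam q ψ ∧
    (∀ φ : ℝ → Fin 2 → ℂ, IsJostSolution lam q φ → φ = ψ) ∧
    Tendsto (fun x : ℝ => Complex.exp (Complex.I * lam ^ 2 * x) * ψ x 0) atTop (𝓝 a)

end

/-!
Write `κ = k / i`, so that `Re κ > 0`, and `e_η(x) = exp (2πixη)`. Both `Γ` and the adjoint of `Λ`
have the form `m(∂) q̄ B`, and the Fourier transform of `q̄ B f` at `η` is `⟨q e_η, B f⟩`.
Parseval's identity therefore shows that `Λ` and `Γ` are Hilbert–Schmidt, so that `Λ Γ` is trace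
class, and that `Λ Γ` is the integral over frequencies `η` of the rank one operators `(κ + 2πiη)⁻¹
⟨((κ - ∂)^{-1/2})^* (q e_η), ·⟩ (κ - ∂)^{-1/2} (q e_η)` (`inner_LambdaOp_GammaOp`).

For such an integral of rank one operators, the sum of the principal minors in any Hilbert basis
is Fredholm's series for the kernel formed by the inner products of the vectors
(`hasSum_principalMinor_of_integral`): Andréief's identity expresses each minor as an integral
over `n` frequencies, and Hadamard's inequality makes the sum converge absolutely, uniformly over
finite parts of the basis.

In the kernel over frequencies the two factors `(κ - ∂)^{-1/2}` combine into `(κ - ∂)⁻¹`, and the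
kernel is a product of one kernel in `(η, x)` and one in `(x, η')`. The Fredholm series of a
product of two integral kernels does not depend on their order (`integral_det_kernel_comm`), which
yields the kernel of `-k q̄ (κ - ∂)⁻¹ q (κ + ∂)⁻¹` in position space
(`integral_det_frequency_eq`). An integration by parts (`norm_resolventModulate_le`) supplies the
decay in `η` that this interchange requires. Up to conjugation by `exp (κ x)`, this kernel is `-k
w(x) H(max x x')` with `w(x) = q̄(x) exp (2κx)` and `H(x) = ∫_x^∞ q(y) exp (-2κy) dy`.

For such kernels the column of the largest variable can be subtracted from all others
(`maxKernelDet_cons`). Integrating out the variables in decreasing order turns the `n`-th term of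
Fredholm's series into an iterated integral (`integral_maxKernelDet_univ`). These iterated
integrals are the Neumann series of the Volterra equation `u(t) = 1 - k ∫_{x < t} w(x) (H(x) -
H(t)) u(x) dx`, which is what the Kaup–Newell system becomes when the second component is
eliminated; here `u = exp (iλ²x) Ψ₁₁⁻` and `λ² = k`. Its solution tends to `1 - k ∫ w H u` at
`+∞`, and this limit is both the scattering coefficient (`hasScatteringCoeff_of_im_pos`) and the
sum of Fredholm's series. Uniqueness of the Jost solution is a Grönwall argument started at `-∞`
(`SolvesKaupNewell.eq_zero`).
-/

noncomputable section

/-! ### Determinants: integrated rows, the Andréief and Cauchy–Binet identities, Hadamard bounds -/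

section Determinants

open Finset

theorem Matrix.det_apply_transpose {n R : Type*} [Fintype n] [DecidableEq n] [CommRing R]
    (M : Matrix n n R) :
    M.det = ∑ σ : Equiv.Perm n, ((Equiv.Perm.sign σ : ℤ) : R) * ∏ i, M i (σ i) := by
  rw [← Matrix.det_transpose, Matrix.det_apply']
  rfl

section Expansions

variable {n Ω : Type*} [Fintype n] [DecidableEq n]

/-- Expanding the first determinant and absorbing each of its monomials into the rows of the second
gives determinants whose `i`-th row depends on `ω i` only, so that they can be integrated or summed
row by row. -/
theorem det_mul_det_eq_sum (a b : n → Ω → ℂ) (ω : n → Ω) :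
    Matrix.det (Matrix.of fun i j => a i (ω j)) * Matrix.det (Matrix.of fun i j => b i (ω j)) =
      ∑ σ : Equiv.Perm n, ((Equiv.Perm.sign σ : ℤ) : ℂ) *
        Matrix.det (Matrix.of fun i j => a (σ i) (ω i) * b j (ω i)) := by
  rw [Matrix.det_apply' (Matrix.of fun i j => a i (ω j)), sum_mul]
  refine sum_congr rfl fun σ _ => ?_
  have h := Matrix.det_mul_column (fun i => a (σ i) (ω i)) (Matrix.of fun i j => b j (ω i))
  have h2 := Matrix.det_transpose (Matrix.of fun i j => b i (ω j))
  have h3 : (Matrix.of fun i j => b i (ω j)).transpose = Matrix.of fun i j => b j (ω i) := by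
    ext; simp
  rw [h3] at h2
  rw [h2] at h
  simp only [Matrix.of_apply] at h ⊢
  rw [h, mul_assoc]

theorem sum_sign_mul_det_perm (M : Matrix n n ℂ) :
    ∑ σ : Equiv.Perm n, ((Equiv.Perm.sign σ : ℤ) : ℂ) *
        Matrix.det (Matrix.of fun i j => M (σ i) j) = (Fintype.card n).factorial * M.det := by
  have : ∀ σ : Equiv.Perm n, ((Equiv.Perm.sign σ : ℤ) : ℂ) *
      Matrix.det (Matrix.of fun i j => M (σ i) j) = M.det := by
    intro σ
    have h := Matrix.det_permute σ M
    have h' : M.submatrix σ id = Matrix.of fun i j => M (σ i) j := by ext; simp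
    rw [h'] at h
    rw [h, ← mul_assoc]
    rcases Int.units_eq_one_or (Equiv.Perm.sign σ) with h | h <;> simp [h]
  rw [sum_congr rfl fun σ _ => this σ, sum_const, card_univ, Fintype.card_perm, nsmul_eq_mul]

end Expansions

section Integrals

variable {n Ω : Type*} [Fintype n] [DecidableEq n] [MeasurableSpace Ω]
  {μ : Measure Ω} [SigmaFinite μ]

theorem integrable_det_row {f : n → n → Ω → ℂ} (hf : ∀ i j, Integrable (f i j) μ) :
    Integrable (fun ω : n → Ω => Matrix.det (Matrix.of fun i j => f i j (ω i)))
      (Measure.pi fun _ => μ) := by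
  simp_rw [Matrix.det_apply_transpose]
  refine integrable_finsetSum _ fun σ _ => Integrable.const_mul ?_ _
  exact Integrable.fintype_prod (f := fun i => f i (σ i)) fun i => hf i (σ i)

/-- If each row depends on its own variable, integration can be carried out entrywise. -/
theorem integral_det_row {f : n → n → Ω → ℂ} (hf : ∀ i j, Integrable (f i j) μ) :
    ∫ ω : n → Ω, Matrix.det (Matrix.of fun i j => f i j (ω i)) ∂(Measure.pi fun _ => μ) =
      Matrix.det (Matrix.of fun i j => ∫ ω, f i j ω ∂μ) := by
  simp_rw [Matrix.det_apply_transpose]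
  rw [integral_finsetSum]
  · refine sum_congr rfl fun σ _ => ?_
    rw [integral_const_mul]
    congr 1
    exact integral_fintype_prod_eq_prod (f := fun i => f i (σ i))
  · intro σ _
    exact (Integrable.fintype_prod (f := fun i => f i (σ i)) fun i => hf i (σ i)).const_mul _

/-- Andréief's identity. -/
theorem integral_det_mul_det {a b : n → Ω → ℂ}
    (hab : ∀ i j, Integrable (fun ω => a i ω * b j ω) μ) :
    ∫ ω : n → Ω, Matrix.det (Matrix.of fun i j => a i (ω j)) *
        Matrix.det (Matrix.of fun i j => b i (ω j)) ∂(Measure.pi fun _ => μ) =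
      (Fintype.card n).factorial * Matrix.det (Matrix.of fun i j => ∫ ω, a i ω * b j ω ∂μ) := by
  simp_rw [det_mul_det_eq_sum]
  rw [integral_finsetSum, ← sum_sign_mul_det_perm]
  · refine sum_congr rfl fun σ _ => ?_
    rw [integral_const_mul, integral_det_row (f := fun i j ω => a (σ i) ω * b j ω)
      fun i j => hab (σ i) j]
    rfl
  · intro σ _
    exact (integrable_det_row (f := fun i j ω => a (σ i) ω * b j ω)
      fun i j => hab (σ i) j).const_mul _

theorem integrable_det_mul_det {a b : n → Ω → ℂ}
    (hab : ∀ i j, Integrable (fun ω => a i ω * b j ω) μ) :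
    Integrable (fun ω : n → Ω => Matrix.det (Matrix.of fun i j => a i (ω j)) *
        Matrix.det (Matrix.of fun i j => b i (ω j))) (Measure.pi fun _ => μ) := by
  simp_rw [det_mul_det_eq_sum]
  refine integrable_finsetSum _ fun σ _ => ?_
  exact (integrable_det_row (f := fun i j ω => a (σ i) ω * b j ω)
      fun i j => hab (σ i) j).const_mul _

end Integrals

section Sums

variable {n ι : Type*} [Fintype n] [DecidableEq n]

theorem sum_det_row (S : Finset ι) (f : n → n → ι → ℂ) :
    ∑ p ∈ Fintype.piFinset (fun _ : n => S), Matrix.det (Matrix.of fun i j => f i j (p i)) =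
      Matrix.det (Matrix.of fun i j => ∑ s ∈ S, f i j s) := by
  simp_rw [Matrix.det_apply_transpose]
  rw [sum_comm]
  refine sum_congr rfl fun σ _ => ?_
  rw [← mul_sum]
  congr 1
  exact (prod_univ_sum (fun _ : n => S) (fun i s => f i (σ i) s)).symm

/-- The Cauchy–Binet formula, as a sum over ordered tuples; the discrete form of Andréief's
identity. -/
theorem sum_det_mul_det (S : Finset ι) (a b : n → ι → ℂ) :
    ∑ p ∈ Fintype.piFinset (fun _ : n => S), Matrix.det (Matrix.of fun i j => a i (p j)) *
        Matrix.det (Matrix.of fun i j => b i (p j)) =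
      (Fintype.card n).factorial * Matrix.det (Matrix.of fun i j => ∑ s ∈ S, a i s * b j s) := by
  simp_rw [det_mul_det_eq_sum]
  rw [sum_comm, ← sum_sign_mul_det_perm]
  refine sum_congr rfl fun σ _ => ?_
  rw [← mul_sum, sum_det_row S (fun i j s => a (σ i) s * b j s)]
  rfl

open scoped ComplexOrder in
/-- Hadamard's inequality for positive semidefinite matrices with unit diagonal: the
arithmetic-geometric mean inequality for the eigenvalues. -/
theorem Matrix.PosSemidef.norm_det_le_one {G : Matrix n n ℂ} (hG : G.PosSemidef)
    (h1 : ∀ i, G i i = 1) : ‖G.det‖ ≤ 1 := by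
  rcases isEmpty_or_nonempty n with hn | hn
  · simp
  have hc : (0 : ℝ) < Fintype.card n := by exact_mod_cast Fintype.card_pos
  have htr : ∑ i, hG.1.eigenvalues i = Fintype.card n := by
    have := hG.1.trace_eq_sum_eigenvalues
    rw [Matrix.trace] at this
    simp only [Matrix.diag_apply, h1, sum_const, card_univ, nsmul_eq_mul, mul_one] at this
    have h' := congrArg Complex.re this
    simpa using h'.symm
  have hag := Real.geom_mean_le_arith_mean_weighted univ (fun _ => (Fintype.card n : ℝ)⁻¹)
    hG.1.eigenvalues (fun i _ => by positivity) (by simp [hc.ne'])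
    (fun i _ => hG.eigenvalues_nonneg i)
  rw [← mul_sum, htr, inv_mul_cancel₀ hc.ne',
    Real.finsetProd_rpow _ _ (fun i _ => hG.eigenvalues_nonneg i)] at hag
  rw [hG.1.det_eq_prod_eigenvalues, norm_prod]
  have h0 : 0 ≤ ∏ i, hG.1.eigenvalues i := prod_nonneg fun i _ => hG.eigenvalues_nonneg i
  have hp : ∏ i, hG.1.eigenvalues i ≤ 1 := by
    by_contra hcon
    push Not at hcon
    exact absurd hag (not_le.2 (Real.one_lt_rpow hcon (by positivity)))
  refine le_trans (le_of_eq ?_) hp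
  refine prod_congr rfl fun i _ => ?_
  simp [abs_of_nonneg (hG.eigenvalues_nonneg i)]

open scoped ComplexOrder in
/-- Hadamard's inequality for a Gram matrix. -/
theorem norm_det_mul_conjTranspose_le {m : Type*} [Fintype m] (B : Matrix n m ℂ) :
    ‖(B * B.conjTranspose).det‖ ≤ ∏ i, ∑ j, ‖B i j‖ ^ 2 := by
  by_cases h : ∃ i, ∑ j, ‖B i j‖ ^ 2 = 0
  · obtain ⟨i, hi⟩ := h
    have hz : ∀ j, B i j = 0 := by
      intro j
      have := (sum_eq_zero_iff_of_nonneg (fun j _ => by positivity)).1 hi j (mem_univ j)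
      simpa using this
    have hd : (B * B.conjTranspose).det = 0 := by
      refine Matrix.det_eq_zero_of_row_eq_zero i fun j => ?_
      simp [Matrix.mul_apply, hz]
    rw [hd, norm_zero]
    exact prod_nonneg fun i _ => sum_nonneg fun j _ => by positivity
  · push Not at h
    set r : n → ℝ := fun i => Real.sqrt (∑ j, ‖B i j‖ ^ 2) with hr
    have hpos : ∀ i, 0 < ∑ j, ‖B i j‖ ^ 2 := fun i =>
      lt_of_le_of_ne (sum_nonneg fun j _ => by positivity) (h i).symm
    have hr0 : ∀ i, 0 < r i := fun i => Real.sqrt_pos.2 (hpos i)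
    have hr2 : ∀ i, r i ^ 2 = ∑ j, ‖B i j‖ ^ 2 := fun i => Real.sq_sqrt (hpos i).le
    set C : Matrix n m ℂ := Matrix.of fun i j => ((r i)⁻¹ : ℂ) * B i j with hC
    have hBC : B * B.conjTranspose =
        Matrix.diagonal (fun i => (r i : ℂ)) * (C * C.conjTranspose) *
          Matrix.diagonal (fun i => (r i : ℂ)) := by
      ext i j
      rw [Matrix.mul_diagonal, Matrix.diagonal_mul, Matrix.mul_apply, Matrix.mul_apply, mul_sum,
        sum_mul]
      refine sum_congr rfl fun l _ => ?_
      have h1 : (r i : ℂ) ≠ 0 := by exact_mod_cast (hr0 i).ne'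
      have h2 : (r j : ℂ) ≠ 0 := by exact_mod_cast (hr0 j).ne'
      simp [hC]
      field_simp
    have hdet : ‖(C * C.conjTranspose).det‖ ≤ 1 := by
      refine (Matrix.posSemidef_self_mul_conjTranspose C).norm_det_le_one fun i => ?_
      rw [Matrix.mul_apply]
      have h1 : (r i : ℂ) ≠ 0 := by exact_mod_cast (hr0 i).ne'
      have : ∀ j, C i j * C.conjTranspose j i = ((r i : ℂ) ^ 2)⁻¹ * ((‖B i j‖ ^ 2 : ℝ) : ℂ) := by
        intro j
        have := Complex.mul_conj' (B i j)
        simp only [hC, Matrix.conjTranspose_apply, Matrix.of_apply, star_mul', RCLike.star_def,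
          map_inv₀, Complex.conj_ofReal]
        push_cast
        rw [← this]
        field_simp
      simp_rw [this]
      rw [← mul_sum, ← Complex.ofReal_sum, ← hr2]
      push_cast
      field_simp
    rw [hBC, Matrix.det_mul, Matrix.det_mul, Matrix.det_diagonal, norm_mul, norm_mul, norm_prod]
    have hrn : ∏ i, ‖(r i : ℂ)‖ = ∏ i, r i :=
      prod_congr rfl fun i _ => by simp [abs_of_pos (hr0 i)]
    rw [hrn]
    have hP : 0 ≤ ∏ i, r i := prod_nonneg fun i _ => (hr0 i).le
    calc (∏ i, r i) * ‖(C * C.conjTranspose).det‖ * ∏ i, r i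
        ≤ (∏ i, r i) * 1 * ∏ i, r i := by gcongr
      _ = ∏ i, ∑ j, ‖B i j‖ ^ 2 := by
        rw [mul_one, ← prod_mul_distrib]
        exact prod_congr rfl fun i _ => by rw [← hr2, sq]

/-- Hadamard's inequality in the space of antisymmetric tensors: the coordinates
`det [a i (p j)]` of `a₁ ∧ ⋯ ∧ aₙ` are square summable with the expected bound. -/
theorem sum_norm_det_sq_le (S : Finset ι) (a : n → ι → ℂ) :
    ∑ p ∈ Fintype.piFinset (fun _ : n => S), ‖Matrix.det (Matrix.of fun i j => a i (p j))‖ ^ 2 ≤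
      (Fintype.card n).factorial * ∏ i, ∑ s ∈ S, ‖a i s‖ ^ 2 := by
  have h1 := sum_det_mul_det S a (fun i s => conj (a i s))
  have h2 : ∀ p : n → ι, Matrix.det (Matrix.of fun i j => a i (p j)) *
      Matrix.det (Matrix.of fun i j => conj (a i (p j))) =
      ((‖Matrix.det (Matrix.of fun i j => a i (p j))‖ ^ 2 : ℝ) : ℂ) := by
    intro p
    have : Matrix.det (Matrix.of fun i j => conj (a i (p j))) =
        conj (Matrix.det (Matrix.of fun i j => a i (p j))) := by
      rw [RingHom.map_det]
      rfl
    rw [this, Complex.mul_conj']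
    push_cast
    rfl
  simp_rw [h2] at h1
  rw [← Complex.ofReal_sum] at h1
  set B : Matrix n S ℂ := Matrix.of fun i s => a i s with hB
  have h3 : (Matrix.of fun i j => ∑ s ∈ S, a i s * conj (a j s)) = B * B.conjTranspose := by
    ext i j
    rw [Matrix.mul_apply, Matrix.of_apply, ← sum_attach]
    rfl
  rw [h3] at h1
  have h4 := congrArg norm h1
  rw [Complex.norm_real, Real.norm_of_nonneg (sum_nonneg fun _ _ => by positivity), norm_mul,
    Complex.norm_natCast] at h4
  rw [h4]
  refine mul_le_mul_of_nonneg_left ?_ (by positivity)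
  refine (norm_det_mul_conjTranspose_le B).trans (le_of_eq ?_)
  refine prod_congr rfl fun i _ => ?_
  rw [← sum_attach S]
  rfl

theorem sum_norm_det_mul_det_le (S : Finset ι) (a b : n → ι → ℂ) {A B : n → ℝ}
    (hA0 : ∀ i, 0 ≤ A i) (hB0 : ∀ i, 0 ≤ B i)
    (hA : ∀ i, ∑ s ∈ S, ‖a i s‖ ^ 2 ≤ A i ^ 2) (hB : ∀ i, ∑ s ∈ S, ‖b i s‖ ^ 2 ≤ B i ^ 2) :
    ∑ p ∈ Fintype.piFinset (fun _ : n => S), ‖Matrix.det (Matrix.of fun i j => a i (p j)) *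
        Matrix.det (Matrix.of fun i j => b i (p j))‖ ≤
      (Fintype.card n).factorial * ∏ i, A i * B i := by
  have key : ∀ (c : n → ι → ℂ) (C : n → ℝ), (∀ i, 0 ≤ C i) →
      (∀ i, ∑ s ∈ S, ‖c i s‖ ^ 2 ≤ C i ^ 2) →
      Real.sqrt (∑ p ∈ Fintype.piFinset (fun _ : n => S),
        ‖Matrix.det (Matrix.of fun i j => c i (p j))‖ ^ 2) ≤
      Real.sqrt (Fintype.card n).factorial * ∏ i, C i := by
    intro c C hC0 hC
    have hP : 0 ≤ ∏ i, C i := prod_nonneg fun i _ => hC0 i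
    rw [← Real.sqrt_sq hP, ← Real.sqrt_mul (by positivity)]
    refine Real.sqrt_le_sqrt ((sum_norm_det_sq_le S c).trans ?_)
    refine mul_le_mul_of_nonneg_left ?_ (by positivity)
    rw [← prod_pow]
    exact prod_le_prod (fun i _ => sum_nonneg fun _ _ => by positivity) fun i _ => hC i
  simp_rw [norm_mul]
  refine (Real.sum_mul_le_sqrt_mul_sqrt _ _ _).trans ?_
  refine (mul_le_mul (key a A hA0 hA) (key b B hB0 hB) (Real.sqrt_nonneg _)
    (mul_nonneg (Real.sqrt_nonneg _) (prod_nonneg fun i _ => hA0 i))).trans (le_of_eq ?_)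
  rw [prod_mul_distrib, mul_mul_mul_comm, Real.mul_self_sqrt (by positivity)]

/-- Summing over ordered tuples counts each principal minor once for every ordering of its index
set; tuples with a repeated index contribute zero. -/
theorem sum_piFinset_det_submatrix {M : Type*} [AddCommMonoid M] [DecidableEq ι] (t : Matrix ι ι ℂ)
    (S : Finset ι) (m : ℕ) (φ : ℂ → M) (h0 : φ 0 = 0) :
    ∑ p ∈ Fintype.piFinset (fun _ : Fin m => S),
        φ (Matrix.det (Matrix.of fun i j => t (p i) (p j))) =
      m.factorial • ∑ s ∈ powersetCard m S,
        φ (Matrix.det (Matrix.of fun i j : s => t i j)) := by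
  classical
  set P := (Fintype.piFinset (fun _ : Fin m => S)).filter Function.Injective with hP
  have h1 : ∑ p ∈ Fintype.piFinset (fun _ : Fin m => S),
      φ (Matrix.det (Matrix.of fun i j => t (p i) (p j))) =
      ∑ p ∈ P, φ (Matrix.det (Matrix.of fun i j => t (p i) (p j))) := by
    symm
    refine sum_subset (filter_subset _ _) fun p hp hn => ?_
    have hni : ¬ Function.Injective p := fun h => hn (mem_filter.2 ⟨hp, h⟩)
    rw [Function.Injective] at hni
    push Not at hni
    obtain ⟨i, j, hij, hne⟩ := hni
    rw [Matrix.det_zero_of_row_eq hne, h0]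
    ext l
    simp [hij]
  have hmaps : ∀ p ∈ P, univ.image p ∈ powersetCard m S := by
    intro p hp
    obtain ⟨hp1, hp2⟩ := mem_filter.1 hp
    rw [mem_powersetCard]
    refine ⟨fun x hx => ?_, ?_⟩
    · obtain ⟨i, -, rfl⟩ := mem_image.1 hx
      exact Fintype.mem_piFinset.1 hp1 i
    · rw [card_image_of_injective _ hp2]
      simp
  rw [h1, ← sum_fiberwise_of_maps_to hmaps, smul_sum]
  refine sum_congr rfl fun s hs => ?_
  obtain ⟨hsS, hsc⟩ := mem_powersetCard.1 hs
  have hfib : P.filter (fun p => univ.image p = s) =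
      univ.image (fun (e : Fin m ≃ s) (i : Fin m) => (e i : ι)) := by
    ext p
    simp only [mem_filter, mem_image, mem_univ, true_and, hP, Fintype.mem_piFinset]
    constructor
    · rintro ⟨⟨-, hinj⟩, him⟩
      have hmem : ∀ i, p i ∈ s := fun i => him ▸ mem_image_of_mem p (mem_univ i)
      have hbij : Function.Bijective (fun i => (⟨p i, hmem i⟩ : s)) := by
        refine ⟨fun i j hij => hinj (by simpa using hij), fun y => ?_⟩
        obtain ⟨i, -, hi⟩ := mem_image.1 (him.symm ▸ y.2 : (y : ι) ∈ univ.image p)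
        exact ⟨i, Subtype.ext hi⟩
      exact ⟨Equiv.ofBijective _ hbij, rfl⟩
    · rintro ⟨e, rfl⟩
      refine ⟨⟨fun i => hsS (e i).2, fun i j hij => e.injective (Subtype.ext hij)⟩, ?_⟩
      ext x
      simp only [mem_image, mem_univ, true_and]
      constructor
      · rintro ⟨i, rfl⟩
        exact (e i).2
      · intro hx
        exact ⟨e.symm ⟨x, hx⟩, by simp⟩
  have hinj : Function.Injective (fun (e : Fin m ≃ s) (i : Fin m) => (e i : ι)) := by
    intro e e' h
    ext i
    exact congrFun h i
  rw [hfib, sum_image fun _ _ _ _ h => hinj h]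
  have hval : ∀ e : Fin m ≃ s, Matrix.det (Matrix.of fun i j => t (e i) (e j)) =
      Matrix.det (Matrix.of fun i j : s => t i j) := fun e =>
    Matrix.det_submatrix_equiv_self e (Matrix.of fun i j : s => t i j)
  simp_rw [hval]
  rw [sum_const, card_univ, Fintype.card_equiv (Fintype.equivFinOfCardEq (by simp [hsc])).symm]
  simp

end Sums

end Determinants

/-! ### Cyclicity of the Fredholm expansion -/

section Cyclicity

variable {Ω Θ : Type*} [MeasurableSpace Ω] [MeasurableSpace Θ]
  {μ : Measure Ω} {ν : Measure Θ} [SigmaFinite μ] [SigmaFinite ν]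

/-- Cyclicity of the Fredholm expansion of a product of two integral kernels: the terms for `A B`
and for `B A` agree. Both are iterated integrals of `det [a (ωᵢ) (θⱼ)] ∏ⱼ b (θⱼ) (ωⱼ)`. -/
theorem integral_det_kernel_comm (n : ℕ) {a : Ω → Θ → ℂ} {b : Θ → Ω → ℂ}
    (ha : Measurable (Function.uncurry a)) (hb : Measurable (Function.uncurry b))
    (ha1 : ∀ ω θ, ‖a ω θ‖ ≤ 1) {α : Ω → ℝ} {β : Θ → ℝ} (hα : Integrable α μ)
    (hβ : Integrable β ν) (hb1 : ∀ θ ω, ‖b θ ω‖ ≤ β θ * α ω) :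
    ∫ ω : Fin n → Ω, Matrix.det (Matrix.of fun i j => ∫ θ, a (ω i) θ * b θ (ω j) ∂ν)
        ∂(Measure.pi fun _ => μ) =
      ∫ θ : Fin n → Θ, Matrix.det (Matrix.of fun i j => ∫ ω, b (θ i) ω * a ω (θ j) ∂μ)
        ∂(Measure.pi fun _ => ν) := by
  have hab : ∀ ω ω' θ, ‖a ω θ * b θ ω'‖ ≤ β θ * α ω' := fun ω ω' θ => by
    rw [norm_mul]
    exact (mul_le_of_le_one_left (norm_nonneg _) (ha1 ω θ)).trans (hb1 θ ω')
  set F : (Fin n → Ω) → (Fin n → Θ) → ℂ := fun ω θ =>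
    Matrix.det (Matrix.of fun i j => a (ω i) (θ j)) * ∏ j, b (θ j) (ω j) with hF
  have h1 : ∀ ω : Fin n → Ω,
      Matrix.det (Matrix.of fun i j => ∫ θ, a (ω i) θ * b θ (ω j) ∂ν) =
        ∫ θ, F ω θ ∂(Measure.pi fun _ => ν) := by
    intro ω
    rw [← Matrix.det_transpose]
    have := integral_det_row (μ := ν) (n := Fin n)
      (f := fun i j θ => a (ω j) θ * b θ (ω i)) (fun i j => by
        refine (hβ.mul_const (α (ω i))).mono' ?_ (Eventually.of_forall fun θ => hab _ _ _)
        exact Measurable.aestronglyMeasurable (by fun_prop))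
    refine (Eq.trans ?_ this.symm).trans ?_
    · congr 1
    · refine integral_congr_ae (Eventually.of_forall fun θ => ?_)
      have h := Matrix.det_mul_row (fun j => b (θ j) (ω j)) (Matrix.of fun i j => a (ω i) (θ j))
      simp only [Matrix.of_apply] at h
      simp only [hF]
      rw [mul_comm, ← h, ← Matrix.det_transpose]
      congr 1
      ext i j
      simp [mul_comm]
  have h2 : ∀ θ : Fin n → Θ,
      Matrix.det (Matrix.of fun i j => ∫ ω, b (θ i) ω * a ω (θ j) ∂μ) =
        ∫ ω, F ω θ ∂(Measure.pi fun _ => μ) := by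
    intro θ
    rw [← integral_det_row (μ := μ) (n := Fin n)
      (f := fun i j ω => b (θ i) ω * a ω (θ j)) (fun i j => by
        refine (hα.const_mul (β (θ i))).mono' ?_ (Eventually.of_forall fun ω => ?_)
        · exact Measurable.aestronglyMeasurable (by fun_prop)
        · rw [norm_mul, mul_comm]
          exact (mul_le_of_le_one_left (norm_nonneg _) (ha1 _ _)).trans (hb1 _ _))]
    refine integral_congr_ae (Eventually.of_forall fun ω => ?_)
    have h := Matrix.det_mul_column (fun i => b (θ i) (ω i)) (Matrix.of fun i j => a (ω i) (θ j))
    simp only [Matrix.of_apply] at h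
    simp only [hF]
    rw [h, mul_comm]
  simp_rw [h1, h2]
  refine integral_integral_swap ?_
  have hbd : Integrable (fun z : (Fin n → Ω) × (Fin n → Θ) =>
      (n.factorial : ℝ) * ((∏ j, α (z.1 j)) * ∏ j, β (z.2 j)))
      ((Measure.pi fun _ => μ).prod (Measure.pi fun _ => ν)) :=
    ((Integrable.fintype_prod (f := fun _ : Fin n => α) fun _ => hα).mul_prod
      (Integrable.fintype_prod (f := fun _ : Fin n => β) fun _ => hβ)).const_mul _
  refine hbd.mono' ?_ (Eventually.of_forall fun z => ?_)
  · refine Measurable.aestronglyMeasurable ?_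
    simp only [Function.uncurry_def, hF, Matrix.det_apply', Matrix.of_apply]
    refine Measurable.mul (Finset.measurable_fun_sum _ fun σ _ => Measurable.const_mul
      (Finset.measurable_fun_prod _ fun i _ => ?_) _) (Finset.measurable_fun_prod _ fun i _ => ?_)
    · exact ha.comp (f := fun z : (Fin n → Ω) × (Fin n → Θ) => (z.1 (σ i), z.2 i)) (by fun_prop)
    · exact hb.comp (f := fun z : (Fin n → Ω) × (Fin n → Θ) => (z.2 i, z.1 i)) (by fun_prop)
  · simp only [Function.uncurry_def, hF]
    rw [norm_mul, ← Finset.prod_mul_distrib]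
    refine mul_le_mul ?_ ?_ (norm_nonneg _) (by positivity)
    · rw [Matrix.det_apply']
      refine (norm_sum_le _ _).trans ?_
      have : ∀ σ : Equiv.Perm (Fin n), ‖((Equiv.Perm.sign σ : ℤ) : ℂ) *
          ∏ i, a (z.1 (σ i)) (z.2 i)‖ ≤ 1 := by
        intro σ
        have hs : ‖((Equiv.Perm.sign σ : ℤ) : ℂ)‖ = 1 := by
          rcases Int.units_eq_one_or (Equiv.Perm.sign σ) with h | h <;> simp [h]
        rw [norm_mul, hs, one_mul, norm_prod]
        exact Finset.prod_le_one (fun _ _ => norm_nonneg _) fun i _ => ha1 _ _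
      refine (Finset.sum_le_sum fun σ _ => this σ).trans (le_of_eq ?_)
      simp [Fintype.card_perm]
    · rw [norm_prod]
      refine Finset.prod_le_prod (fun _ _ => norm_nonneg _) fun i _ => ?_
      rw [mul_comm]
      exact hb1 _ _

end Cyclicity

/-! ### Principal minors of an integral of rank one operators -/

section FredholmExpansion

universe u

variable {E : Type u} [NormedAddCommGroup E] [InnerProductSpace ℂ E] {ι : Type u}
  {Ω : Type*} [MeasurableSpace Ω] {μ : Measure Ω} [SigmaFinite μ]

/-- In a Hilbert basis, the sum of the principal minors of `T = ∫ ⟨x ω, ·⟩ y ω dμ` with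
`∫ ‖x ω‖ ‖y ω‖ dμ < ∞` is Fredholm's series built on the kernel `⟨x ω, y ω'⟩`. Andréief's identity
writes the minors as integrals, and Hadamard's inequality in `⋀ⁿ E` bounds the minors of size `n`,
in any finite part of the basis, by `(∫ c) ^ n / n!`; the series over all index sets therefore
converges absolutely and can be summed along the exhaustion by the subsets of a finite `S`. -/
theorem hasSum_principalMinor_of_integral [Countable ι] (b : HilbertBasis ι ℂ E) (T : E →L[ℂ] E)
    {x y : Ω → E} {c : Ω → ℝ} (hc : Integrable c μ) (hxy : ∀ ω, ‖x ω‖ * ‖y ω‖ ≤ c ω)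
    (hx : ∀ i, Measurable fun ω => inner ℂ (x ω) (b i))
    (hy : ∀ i, Measurable fun ω => inner ℂ (b i) (y ω))
    (hT : ∀ i j, inner ℂ (b i) (T (b j)) =
      ∫ ω, inner ℂ (b i) (y ω) * inner ℂ (x ω) (b j) ∂μ) :
    HasSum (principalMinor b T) (∑' n : ℕ, (n.factorial : ℂ)⁻¹ *
      ∫ ω : Fin n → Ω, Matrix.det (Matrix.of fun p q => inner ℂ (x (ω p)) (y (ω q)))
        ∂(Measure.pi fun _ => μ)) := by
  classical
  set l : ι → Ω → ℂ := fun i ω => inner ℂ (b i) (y ω) with hl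
  set g : ι → Ω → ℂ := fun i ω => inner ℂ (x ω) (b i) with hg
  set t : Matrix ι ι ℂ := Matrix.of fun i j => inner ℂ (b i) (T (b j)) with ht
  set C : ℝ := ∫ ω, c ω ∂μ with hC
  have hc0 : ∀ ω, 0 ≤ c ω := fun ω => le_trans (by positivity) (hxy ω)
  have hC0 : 0 ≤ C := integral_nonneg hc0
  have hnb : ∀ i, ‖b i‖ = 1 := fun i => b.orthonormal.1 i
  have hlg : ∀ i j, Integrable (fun ω => l i ω * g j ω) μ := by
    intro i j
    refine hc.mono' ((hy i).mul (hx j)).aestronglyMeasurable (Eventually.of_forall fun ω => ?_)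
    rw [norm_mul]
    have h1 := norm_inner_le_norm (𝕜 := ℂ) (b i) (y ω)
    have h2 := norm_inner_le_norm (𝕜 := ℂ) (x ω) (b j)
    rw [hnb] at h1 h2
    refine le_trans (mul_le_mul h1 h2 (norm_nonneg _) (by positivity)) ?_
    calc _ = ‖x ω‖ * ‖y ω‖ := by ring
      _ ≤ c ω := hxy ω
  have hcprod : ∀ n : ℕ, Integrable (fun ω : Fin n → Ω => ∏ i, c (ω i)) (Measure.pi fun _ => μ) :=
    fun n => Integrable.fintype_prod (f := fun _ : Fin n => c) fun _ => hc
  have hcint : ∀ n : ℕ, ∫ ω : Fin n → Ω, ∏ i, c (ω i) ∂(Measure.pi fun _ => μ) = C ^ n := by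
    intro n
    rw [integral_fintype_prod_eq_prod (f := fun _ : Fin n => c)]
    simp [hC]
  -- The pointwise Hadamard bound, uniform in the finite set `S`
  have hpt : ∀ (n : ℕ) (S : Finset ι) (ω : Fin n → Ω),
      ∑ p ∈ Fintype.piFinset (fun _ : Fin n => S),
        ‖Matrix.det (Matrix.of fun i j => l (p i) (ω j)) *
          Matrix.det (Matrix.of fun i j => g (p i) (ω j))‖ ≤ n.factorial * ∏ i, c (ω i) := by
    intro n S ω
    have h := sum_norm_det_mul_det_le S (fun i s => l s (ω i)) (fun i s => g s (ω i))
      (A := fun i => ‖y (ω i)‖) (B := fun i => ‖x (ω i)‖) (fun i => norm_nonneg _)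
      (fun i => norm_nonneg _)
      (fun i => b.orthonormal.sum_inner_products_le _)
      (fun i => by
        refine le_trans (le_of_eq ?_) (b.orthonormal.sum_inner_products_le (x (ω i)) (s := S))
        exact Finset.sum_congr rfl fun s _ => by rw [hg, norm_inner_symm])
    rw [Fintype.card_fin] at h
    refine le_trans (le_of_eq ?_) (h.trans ?_)
    · refine Finset.sum_congr rfl fun p _ => ?_
      rw [← Matrix.det_transpose, ← Matrix.det_transpose (Matrix.of fun i j => g (p i) (ω j))]
      rfl
    · refine mul_le_mul_of_nonneg_left ?_ (by positivity)
      refine Finset.prod_le_prod (fun i _ => by positivity) fun i _ => ?_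
      rw [mul_comm]
      exact hxy _
  have hdetT : ∀ (n : ℕ) (p : Fin n → ι),
      ∫ ω : Fin n → Ω, Matrix.det (Matrix.of fun i j => l (p i) (ω j)) *
        Matrix.det (Matrix.of fun i j => g (p i) (ω j)) ∂(Measure.pi fun _ => μ) =
      n.factorial * Matrix.det (Matrix.of fun i j => t (p i) (p j)) := by
    intro n p
    rw [integral_det_mul_det fun i j => hlg (p i) (p j), Fintype.card_fin]
    congr 3
    ext i j
    simp only [ht, Matrix.of_apply]
    exact (hT (p i) (p j)).symm
  have hint : ∀ (n : ℕ) (p : Fin n → ι), Integrable (fun ω : Fin n → Ω =>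
      Matrix.det (Matrix.of fun i j => l (p i) (ω j)) *
        Matrix.det (Matrix.of fun i j => g (p i) (ω j))) (Measure.pi fun _ => μ) :=
    fun n p => integrable_det_mul_det fun i j => hlg (p i) (p j)
  have hmin : ∀ s : Finset ι,
      principalMinor b T s = Matrix.det (Matrix.of fun i j : s => t i j) := by
    intro s
    unfold principalMinor
    congr!
  have hfac : ∀ n : ℕ, (n.factorial : ℝ) ≠ 0 := fun n => by positivity
  have hfac' : ∀ n : ℕ, (n.factorial : ℂ) ≠ 0 := fun n => by exact_mod_cast n.factorial_ne_zero
  -- Absolute summability of the minors of size `n`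
  have habs : ∀ (n : ℕ) (S : Finset ι), ∑ s ∈ Finset.powersetCard n S, ‖principalMinor b T s‖ ≤
      C ^ n / n.factorial := by
    intro n S
    have h1 := sum_piFinset_det_submatrix t S n (fun z => ‖z‖) norm_zero
    simp_rw [← hmin] at h1
    rw [nsmul_eq_mul] at h1
    rw [le_div_iff₀ (by positivity), mul_comm, ← h1, ← hcint n,
      ← mul_le_mul_iff_right₀ (show (0 : ℝ) < n.factorial by positivity), Finset.mul_sum]
    calc ∑ p ∈ Fintype.piFinset (fun _ : Fin n => S),
          (n.factorial : ℝ) * ‖Matrix.det (Matrix.of fun i j => t (p i) (p j))‖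
        = ∑ p ∈ Fintype.piFinset (fun _ : Fin n => S), ‖∫ ω : Fin n → Ω,
            Matrix.det (Matrix.of fun i j => l (p i) (ω j)) *
            Matrix.det (Matrix.of fun i j => g (p i) (ω j)) ∂(Measure.pi fun _ => μ)‖ := by
          refine Finset.sum_congr rfl fun p _ => ?_
          rw [hdetT, norm_mul, Complex.norm_natCast]
      _ ≤ ∑ p ∈ Fintype.piFinset (fun _ : Fin n => S), ∫ ω : Fin n → Ω,
            ‖Matrix.det (Matrix.of fun i j => l (p i) (ω j)) *
            Matrix.det (Matrix.of fun i j => g (p i) (ω j))‖ ∂(Measure.pi fun _ => μ) :=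
          Finset.sum_le_sum fun p _ => norm_integral_le_integral_norm _
      _ = ∫ ω : Fin n → Ω, ∑ p ∈ Fintype.piFinset (fun _ : Fin n => S),
            ‖Matrix.det (Matrix.of fun i j => l (p i) (ω j)) *
            Matrix.det (Matrix.of fun i j => g (p i) (ω j))‖ ∂(Measure.pi fun _ => μ) :=
          (integral_finsetSum _ fun p _ => (hint n p).norm).symm
      _ ≤ ∫ ω : Fin n → Ω, n.factorial * ∏ i, c (ω i) ∂(Measure.pi fun _ => μ) :=
          integral_mono (integrable_finsetSum _ fun p _ => (hint n p).norm)
            ((hcprod n).const_mul _) fun ω => hpt n S ω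
      _ = _ := integral_const_mul _ _
  -- The exact value of the sum of the minors of size `n` inside `S`
  set d : ℕ → Finset ι → ℂ := fun n S => ∑ s ∈ Finset.powersetCard n S, principalMinor b T s with hd
  have hval : ∀ (n : ℕ) (S : Finset ι), d n S = (n.factorial : ℂ)⁻¹ *
      ∫ ω : Fin n → Ω, Matrix.det (Matrix.of fun p q => ∑ i ∈ S, l i (ω p) * g i (ω q))
        ∂(Measure.pi fun _ => μ) := by
    intro n S
    have h1 := sum_piFinset_det_submatrix t S n (fun z => z) rfl
    simp_rw [← hmin] at h1
    rw [nsmul_eq_mul] at h1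
    rw [hd]
    simp only
    rw [eq_inv_mul_iff_mul_eq₀ (hfac' n), ← h1, ← mul_right_inj' (hfac' n), Finset.mul_sum,
      ← integral_const_mul]
    simp_rw [← hdetT]
    rw [← integral_finsetSum _ fun p _ => hint n p]
    refine integral_congr_ae (Eventually.of_forall fun ω => ?_)
    have h := sum_det_mul_det S (fun i s => l s (ω i)) (fun i s => g s (ω i))
    rw [Fintype.card_fin] at h
    simp only
    rw [← h]
    refine Finset.sum_congr rfl fun p _ => ?_
    rw [← Matrix.det_transpose, ← Matrix.det_transpose (Matrix.of fun i j => g (p i) (ω j))]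
    rfl
  have hlim : ∀ n : ℕ, Tendsto (fun S => d n S) atTop (𝓝 ((n.factorial : ℂ)⁻¹ *
      ∫ ω : Fin n → Ω, Matrix.det (Matrix.of fun p q => inner ℂ (x (ω p)) (y (ω q)))
        ∂(Measure.pi fun _ => μ))) := by
    intro n
    simp_rw [hval]
    refine Tendsto.const_mul _ ?_
    refine tendsto_integral_filter_of_dominated_convergence (fun ω => ∏ i, c (ω i))
      (Eventually.of_forall fun S => ?_) (Eventually.of_forall fun S =>
        Eventually.of_forall fun ω => ?_) (hcprod n) (Eventually.of_forall fun ω => ?_)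
    · refine Measurable.aestronglyMeasurable ?_
      simp only [Matrix.det_apply', Matrix.of_apply]
      refine Finset.measurable_fun_sum _ fun σ _ => Measurable.const_mul
        (Finset.measurable_fun_prod _ fun i _ => Finset.measurable_fun_sum _ fun s _ => ?_) _
      exact ((hy s).comp (measurable_pi_apply _)).mul ((hx s).comp (measurable_pi_apply _))
    · have h := sum_det_mul_det S (fun i s => l s (ω i)) (fun i s => g s (ω i))
      rw [Fintype.card_fin] at h
      have h2 := hpt n S ω
      rw [← mul_le_mul_iff_right₀ (show (0 : ℝ) < n.factorial by positivity)]
      refine le_trans ?_ h2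
      calc _ = ‖(n.factorial : ℂ) *
            Matrix.det (Matrix.of fun p q => ∑ i ∈ S, l i (ω p) * g i (ω q))‖ := by
              rw [norm_mul, Complex.norm_natCast]
        _ ≤ _ := by
          rw [← h]
          refine (norm_sum_le _ _).trans (le_of_eq (Finset.sum_congr rfl fun p _ => ?_))
          rw [← Matrix.det_transpose, ← Matrix.det_transpose (Matrix.of fun i j => g (p i) (ω j))]
          rfl
    · rw [← Matrix.det_transpose (Matrix.of fun p q => inner ℂ (x (ω p)) (y (ω q)))]
      refine (Continuous.matrix_det continuous_id).continuousAt.tendsto.comp ?_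
      refine tendsto_pi_nhds.2 fun p => tendsto_pi_nhds.2 fun q => ?_
      have := b.hasSum_inner_mul_inner (x (ω q)) (y (ω p))
      simp only [HasSum, SummationFilter.unconditional_filter] at this
      refine this.congr fun S => Finset.sum_congr rfl fun s _ => ?_
      rw [hl, hg, mul_comm]
  have hsplit : ∀ (S : Finset ι) (φ : Finset ι → ℝ), ∑ s ∈ S.powerset, φ s =
      ∑ n ∈ Finset.range (S.card + 1), ∑ s ∈ Finset.powersetCard n S, φ s := fun S φ =>
    Finset.sum_powerset S φ
  have hsplit' : ∀ S : Finset ι, ∑ s ∈ S.powerset, principalMinor b T s = ∑' n, d n S := by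
    intro S
    rw [Finset.sum_powerset, tsum_eq_sum (s := Finset.range (S.card + 1))]
    intro n hn
    simp only [hd]
    rw [Finset.powersetCard_eq_empty.2, Finset.sum_empty]
    simpa using hn
  have hsub : ∀ F : Finset (Finset ι), F ⊆ (F.sup id).powerset := fun F s hs =>
    Finset.mem_powerset.2 (Finset.le_sup (f := id) hs)
  have hsum : Summable (principalMinor b T) := by
    refine Summable.of_norm (summable_of_sum_le (c := Real.exp C) (fun _ => norm_nonneg _)
      fun F => ?_)
    refine (Finset.sum_le_sum_of_subset_of_nonneg (hsub F) fun _ _ _ => norm_nonneg _).trans ?_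
    rw [hsplit]
    exact (Finset.sum_le_sum fun n _ => habs n _).trans (Real.sum_le_exp_of_nonneg hC0 _)
  have hpow : Tendsto (fun S : Finset ι => S.powerset) atTop atTop := by
    refine tendsto_atTop.2 fun F => ?_
    filter_upwards [eventually_ge_atTop (F.sup id)] with S hS
    exact (hsub F).trans (Finset.powerset_mono.2 hS)
  have hlim1 : Tendsto (fun S : Finset ι => ∑ s ∈ S.powerset, principalMinor b T s) atTop
      (𝓝 (∑' s, principalMinor b T s)) := by
    have := hsum.hasSum
    simp only [HasSum, SummationFilter.unconditional_filter] at this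
    exact this.comp hpow
  have hlim2 : Tendsto (fun S : Finset ι => ∑' n, d n S) atTop (𝓝 (∑' n : ℕ, (n.factorial : ℂ)⁻¹ *
      ∫ ω : Fin n → Ω, Matrix.det (Matrix.of fun p q => inner ℂ (x (ω p)) (y (ω q)))
        ∂(Measure.pi fun _ => μ))) := by
    refine tendsto_tsum_of_dominated_convergence (bound := fun n => C ^ n / n.factorial)
      (Real.summable_pow_div_factorial C) hlim (Eventually.of_forall fun S n => ?_)
    exact (norm_sum_le _ _).trans (habs n S)
  simp_rw [hsplit'] at hlim1
  rw [← tendsto_nhds_unique hlim1 hlim2]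
  exact hsum.hasSum

end FredholmExpansion

/-! ### Kernels depending on the larger variable and iterated integrals -/

section Ordering

/-- The integrand of the Fredholm expansion of the kernel `w (x) (H (max x y) - c)`. -/
def maxKernelDet (w H : ℝ → ℂ) (c : ℂ) (n : ℕ) (x : Fin n → ℝ) : ℂ :=
  Matrix.det (Matrix.of fun i j => w (x i) * (H (max (x i) (x j)) - c))

theorem maxKernelDet_comp_perm (w H : ℝ → ℂ) (c : ℂ) (n : ℕ) (x : Fin n → ℝ)
    (σ : Equiv.Perm (Fin n)) : maxKernelDet w H c n (x ∘ σ) = maxKernelDet w H c n x :=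
  Matrix.det_submatrix_equiv_self σ (Matrix.of fun i j => w (x i) * (H (max (x i) (x j)) - c))

/-- If the first point is the largest, its column of the matrix can be subtracted from all others.
This leaves a single entry in its row and the matrix of the same shape with the constant `H y`. -/
theorem maxKernelDet_cons (w H : ℝ → ℂ) (c : ℂ) (n : ℕ) (y : ℝ) (z : Fin n → ℝ)
    (hz : ∀ i, z i < y) :
    maxKernelDet w H c (n + 1) (Fin.cons y z) =
      w y * (H y - c) * maxKernelDet w H (H y) n z := by
  set x : Fin (n + 1) → ℝ := Fin.cons y z with hx
  have hx0 : x 0 = y := rfl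
  have hxs : ∀ i : Fin n, x i.succ = z i := fun i => rfl
  have hle : ∀ i, x i ≤ y := by
    intro i
    refine Fin.cases (le_of_eq hx0) (fun i => ?_) i
    rw [hxs]
    exact (hz i).le
  unfold maxKernelDet
  rw [← Matrix.det_transpose]
  -- After transposition the row of the largest point is constant up to `w`, and subtracting it from
  -- the others clears the first column below the diagonal.
  set B : Matrix (Fin (n + 1)) (Fin (n + 1)) ℂ := Matrix.of fun i j =>
    if i = 0 then w (x j) * (H y - c) else w (x j) * (H (max (x i) (x j)) - H y) with hB
  rw [Matrix.det_eq_of_forall_row_eq_smul_add_const (B := B)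
    (fun i => if i = 0 then 0 else 1) 0 (by simp)]
  · rw [Matrix.det_succ_column_zero, Finset.sum_eq_single 0]
    · simp only [Fin.val_zero, pow_zero, one_mul, hB, Matrix.of_apply, if_true, hx0]
      congr 1
      rw [← Matrix.det_transpose]
      congr 1
      ext i j
      simp [hxs, max_comm]
    · intro i _ hi
      simp [hB, hi, hx0, max_eq_right (hle i)]
    · simp
  · intro i j
    by_cases hi : i = 0
    · subst hi
      simp [hB, hx0, max_eq_right (hle j)]
    · simp only [Matrix.transpose_apply, Matrix.of_apply, hB, hi, if_false, if_true]
      rw [max_comm]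
      ring

theorem ae_injective_pi (n : ℕ) (S : Set ℝ) :
    ∀ᵐ x : Fin n → ℝ ∂(Measure.pi fun _ => (volume : Measure ℝ).restrict S),
      Function.Injective x := by
  rw [← Measure.restrict_pi_pi]
  refine ae_restrict_of_ae ?_
  have h : ∀ i j : Fin n, i ≠ j → ∀ᵐ x : Fin n → ℝ, x i ≠ x j := by
    intro i j hij
    set V : Submodule ℝ (Fin n → ℝ) :=
      LinearMap.ker (LinearMap.proj (R := ℝ) (φ := fun _ : Fin n => ℝ) i - LinearMap.proj j)
    have hV : V ≠ ⊤ := by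
      intro htop
      have : (Pi.single i 1 : Fin n → ℝ) ∈ V := htop ▸ Submodule.mem_top
      simp [V, hij.symm] at this
    have h0 := Measure.addHaar_submodule (volume : Measure (Fin n → ℝ)) V hV
    rw [ae_iff]
    convert h0 using 2
    ext x
    simp [V, sub_eq_zero]
  have h' : ∀ᵐ x : Fin n → ℝ, ∀ i j : Fin n, i ≠ j → x i ≠ x j := by
    simp only [ae_all_iff]
    exact h
  filter_upwards [h'] with x hx i j hij
  by_contra hne
  exact hx i j hne hij

/-- Splitting the integral of a symmetric function according to which variable is the largest. -/
theorem integral_pi_succ_eq_of_symm (n : ℕ) {S : Set ℝ}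
    {G : (Fin (n + 1) → ℝ) → ℂ}
    (hG : Integrable G (Measure.pi fun _ => (volume : Measure ℝ).restrict S))
    (hsymm : ∀ (σ : Equiv.Perm (Fin (n + 1))) x, G (x ∘ σ) = G x) :
    ∫ x, G x ∂(Measure.pi fun _ => (volume : Measure ℝ).restrict S) =
      (n + 1) * ∫ y in S, ∫ z, G (Fin.cons y z)
        ∂(Measure.pi fun _ : Fin n => (volume : Measure ℝ).restrict (S ∩ Set.Iio y)) := by
  set μ : Measure ℝ := (volume : Measure ℝ).restrict S with hμ
  -- `A i` is the region where the `i`-th variable is the largest.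
  set A : Fin (n + 1) → Set (Fin (n + 1) → ℝ) := fun i => {x | ∀ j, j ≠ i → x j < x i} with hA
  have hAm : ∀ i, MeasurableSet (A i) := by
    intro i
    simp only [hA, Set.ofPred_forall]
    refine MeasurableSet.iInter fun j => MeasurableSet.iInter fun _ => ?_
    exact measurableSet_lt (measurable_pi_apply j) (measurable_pi_apply i)
  have hdecomp : ∀ᵐ x ∂(Measure.pi fun _ : Fin (n + 1) => μ), G x = ∑ i, (A i).indicator G x := by
    filter_upwards [ae_injective_pi (n + 1) S] with x hx
    obtain ⟨i, -, hi⟩ := Finset.exists_max_image Finset.univ x ⟨0, Finset.mem_univ _⟩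
    have hiA : x ∈ A i := fun j hj =>
      lt_of_le_of_ne (hi j (Finset.mem_univ _)) fun h => hj (hx h)
    rw [Finset.sum_eq_single i]
    · rw [Set.indicator_of_mem hiA]
    · intro j _ hj
      refine Set.indicator_of_notMem (fun hjA => ?_) _
      exact absurd (hjA i hj.symm) (not_lt.2 (hi j (Finset.mem_univ _)))
    · simp
  have hperm : ∀ i, ∫ x, (A i).indicator G x ∂(Measure.pi fun _ : Fin (n + 1) => μ) =
      ∫ x, (A 0).indicator G x ∂(Measure.pi fun _ : Fin (n + 1) => μ) := by
    intro i
    have hmp := measurePreserving_arrowCongr' (fun _ : Fin (n + 1) => μ)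
      (fun _ : Fin (n + 1) => μ) (Equiv.swap 0 i) (MeasurableEquiv.refl ℝ)
      (fun _ => MeasurePreserving.id _)
    rw [← hmp.integral_comp']
    refine integral_congr_ae (Eventually.of_forall fun x => ?_)
    have hx' : (MeasurableEquiv.arrowCongr' (Equiv.swap 0 i) (MeasurableEquiv.refl ℝ)) x =
        x ∘ (Equiv.swap 0 i) := by
      ext j
      simp [MeasurableEquiv.arrowCongr', Equiv.arrowCongr', Equiv.arrowCongr]
    simp only [hx']
    have hiff : x ∘ (Equiv.swap 0 i) ∈ A i ↔ x ∈ A 0 := by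
      simp only [hA, Set.mem_ofPred_eq, Function.comp_apply, Equiv.swap_apply_right]
      constructor
      · intro h j hj
        have := h (Equiv.swap 0 i j) (fun h' => hj (by
          have := congrArg (Equiv.swap 0 i) h'
          simpa using this))
        simpa using this
      · intro h j hj
        refine h _ fun h' => hj ?_
        have := congrArg (Equiv.swap 0 i) h'
        simpa using this
    by_cases hx : x ∈ A 0
    · rw [Set.indicator_of_mem (hiff.2 hx), Set.indicator_of_mem hx, hsymm]
    · rw [Set.indicator_of_notMem (fun h => hx (hiff.1 h)), Set.indicator_of_notMem hx]
  rw [integral_congr_ae hdecomp, integral_finsetSum _ fun i _ => hG.indicator (hAm i)]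
  simp_rw [hperm]
  rw [Finset.sum_const, Finset.card_univ, Fintype.card_fin, nsmul_eq_mul]
  push_cast
  congr 1
  have hmp := (measurePreserving_piFinSuccAbove (fun _ : Fin (n + 1) => μ) 0).symm
  have hcons : ∀ z : ℝ × (Fin n → ℝ),
      (MeasurableEquiv.piFinSuccAbove (fun _ : Fin (n + 1) => ℝ) 0).symm z = Fin.cons z.1 z.2 := by
    intro z
    simp [MeasurableEquiv.piFinSuccAbove_symm_apply, Fin.insertNthEquiv]
  have hint := (hmp.integrable_comp_emb (MeasurableEquiv.measurableEmbedding _)).2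
    (hG.indicator (hAm 0))
  rw [← hmp.integral_comp']
  refine (integral_prod _ hint).trans ?_
  refine integral_congr_ae (Eventually.of_forall fun y => ?_)
  simp only [Function.comp_apply, hcons]
  have hmem : ∀ z : Fin n → ℝ, (Fin.cons y z : Fin (n + 1) → ℝ) ∈ A 0 ↔
      z ∈ Set.univ.pi fun _ => Set.Iio y := by
    intro z
    simp only [hA, Set.mem_ofPred_eq, Set.mem_univ_pi, Set.mem_Iio, Fin.cons_zero]
    constructor
    · intro h j
      simpa using h j.succ (Fin.succ_ne_zero j)
    · intro h j hj
      obtain ⟨j, rfl⟩ := Fin.exists_succ_eq.2 hj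
      simpa using h j
  have hres : (Measure.pi fun _ : Fin n => (volume : Measure ℝ).restrict (S ∩ Set.Iio y)) =
      (Measure.pi fun _ : Fin n => μ).restrict (Set.univ.pi fun _ => Set.Iio y) := by
    rw [Measure.restrict_pi_pi, hμ, Measure.restrict_restrict measurableSet_Iio, Set.inter_comm]
  rw [hres, ← integral_indicator (MeasurableSet.univ_pi fun _ => measurableSet_Iio)]
  refine integral_congr_ae (Eventually.of_forall fun z => ?_)
  by_cases hz : z ∈ Set.univ.pi fun _ : Fin n => Set.Iio y
  · simp only
    rw [Set.indicator_of_mem hz, Set.indicator_of_mem ((hmem z).2 hz)]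
  · simp only
    rw [Set.indicator_of_notMem hz, Set.indicator_of_notMem fun h => hz ((hmem z).1 h)]

/-- Every entry in row `x` is dominated by `p x`, because the second argument of the kernel is at
least `x`; this controls each of the `n!` monomials. -/
theorem integrable_maxKernelDet {w H : ℝ → ℂ} (hw : Measurable w) (hH : Measurable H) {c : ℂ}
    {S : Set ℝ} (hS : MeasurableSet S) {p : ℝ → ℝ} (hp : Integrable p (volume.restrict S))
    (hb : ∀ x ∈ S, ∀ y ∈ S, x ≤ y → ‖w x * (H y - c)‖ ≤ p x) (n : ℕ) :
    Integrable (maxKernelDet w H c n)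
      (Measure.pi fun _ => (volume : Measure ℝ).restrict S) := by
  have hbd : Integrable (fun x : Fin n → ℝ => (n.factorial : ℝ) * ∏ i, p (x i))
      (Measure.pi fun _ => (volume : Measure ℝ).restrict S) :=
    (Integrable.fintype_prod (f := fun _ : Fin n => p) fun _ => hp).const_mul _
  refine hbd.mono' (Measurable.aestronglyMeasurable ?_) ?_
  · unfold maxKernelDet
    simp only [Matrix.det_apply', Matrix.of_apply]
    fun_prop
  · rw [← Measure.restrict_pi_pi]
    refine ae_restrict_of_forall_mem (MeasurableSet.univ_pi fun _ => hS) fun x hx => ?_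
    have hxS : ∀ i, x i ∈ S := fun i => hx i (Set.mem_univ i)
    unfold maxKernelDet
    rw [Matrix.det_apply_transpose]
    refine (norm_sum_le _ _).trans ?_
    have : ∀ σ : Equiv.Perm (Fin n), ‖((Equiv.Perm.sign σ : ℤ) : ℂ) *
        ∏ i, Matrix.of (fun i j => w (x i) * (H (max (x i) (x j)) - c)) i (σ i)‖ ≤
        ∏ i, p (x i) := by
      intro σ
      have hs : ‖((Equiv.Perm.sign σ : ℤ) : ℂ)‖ = 1 := by
        rcases Int.units_eq_one_or (Equiv.Perm.sign σ) with h | h <;> simp [h]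
      rw [norm_mul, hs, one_mul, norm_prod]
      refine Finset.prod_le_prod (fun _ _ => norm_nonneg _) fun i _ => ?_
      refine hb _ (hxS i) _ ?_ (le_max_left _ _)
      rcases max_choice (x i) (x (σ i)) with h | h <;> rw [h] <;> exact hxS _
    refine (Finset.sum_le_sum fun σ _ => this σ).trans (le_of_eq ?_)
    simp [Fintype.card_perm]

/-- Integrating out the largest variable `y` reduces the number of variables by one, replaces the
constant `c` by `H y`, and confines the remaining variables to the left of `y`. -/
theorem integral_maxKernelDet_succ {w H : ℝ → ℂ} (hw : Measurable w) (hH : Measurable H) {c : ℂ}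
    {S : Set ℝ} (hS : MeasurableSet S) {p : ℝ → ℝ} (hp : Integrable p (volume.restrict S))
    (hb : ∀ x ∈ S, ∀ y ∈ S, x ≤ y → ‖w x * (H y - c)‖ ≤ p x) (n : ℕ) :
    ∫ x, maxKernelDet w H c (n + 1) x ∂(Measure.pi fun _ => (volume : Measure ℝ).restrict S) =
      (n + 1) * ∫ y in S, w y * (H y - c) * ∫ z, maxKernelDet w H (H y) n z
        ∂(Measure.pi fun _ : Fin n => (volume : Measure ℝ).restrict (S ∩ Set.Iio y)) := by
  rw [integral_pi_succ_eq_of_symm n (integrable_maxKernelDet hw hH hS hp hb (n + 1))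
    fun σ x => maxKernelDet_comp_perm w H c (n + 1) x σ]
  congr 1
  refine integral_congr_ae (Eventually.of_forall fun y => ?_)
  simp only
  rw [← integral_const_mul, ← Measure.restrict_pi_pi]
  refine setIntegral_congr_fun (MeasurableSet.univ_pi fun _ => hS.inter measurableSet_Iio)
    fun z hz => ?_
  exact maxKernelDet_cons w H c n y z fun i => (hz i (Set.mem_univ i)).2

/-- The iterated integrals
`∫_{x₁ < t} w x₁ (H x₁ - H t) ∫_{x₂ < x₁} w x₂ (H x₂ - H x₁) ⋯`. -/
def orderedIntegral (w H : ℝ → ℂ) : ℕ → ℝ → ℂ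
  | 0, _ => 1
  | n + 1, t => ∫ x in Set.Iio t, w x * (H x - H t) * orderedIntegral w H n x

theorem integral_maxKernelDet_Iio {w H : ℝ → ℂ} (hw : Measurable w) (hH : Measurable H)
    {p : ℝ → ℝ} (hp : Integrable p)
    (hb : ∀ x y t, x ≤ y → y ≤ t → ‖w x * (H y - H t)‖ ≤ p x) (n : ℕ) (t : ℝ) :
    ∫ x, maxKernelDet w H (H t) n x
        ∂(Measure.pi fun _ => (volume : Measure ℝ).restrict (Set.Iio t)) =
      n.factorial * orderedIntegral w H n t := by
  induction n generalizing t with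
  | zero =>
    simp [maxKernelDet, orderedIntegral, Measure.real]
  | succ n ih =>
    rw [integral_maxKernelDet_succ hw hH measurableSet_Iio hp.integrableOn
      (fun x _ y hy hxy => hb x y t hxy (le_of_lt hy)), orderedIntegral, Nat.factorial_succ]
    push_cast
    rw [mul_assoc]
    congr 1
    rw [← integral_const_mul]
    refine setIntegral_congr_fun measurableSet_Iio fun y hy => ?_
    have hset : Set.Iio t ∩ Set.Iio y = Set.Iio y :=
      Set.inter_eq_right.2 (Set.Iio_subset_Iio (le_of_lt hy))
    simp only [hset, ih]
    ring

/-- The terms of the Fredholm series of the kernel `w (x) H (max x y)` on the whole line are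
iterated integrals. -/
theorem integral_maxKernelDet_univ {w H : ℝ → ℂ} (hw : Measurable w) (hH : Measurable H)
    {p : ℝ → ℝ} (hp : Integrable p) (hb : ∀ x y t, x ≤ y → y ≤ t → ‖w x * (H y - H t)‖ ≤ p x)
    (hb' : ∀ x y, x ≤ y → ‖w x * H y‖ ≤ p x) (n : ℕ) :
    ((n + 1).factorial : ℂ)⁻¹ *
      ∫ x, maxKernelDet w H 0 (n + 1) x ∂(Measure.pi fun _ => (volume : Measure ℝ)) =
      ∫ y, w y * H y * orderedIntegral w H n y := by
  have h := integral_maxKernelDet_succ hw hH (c := 0) MeasurableSet.univ hp.integrableOn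
    (fun x _ y _ hxy => by simpa using hb' x y hxy) n
  simp only [Measure.restrict_univ, Set.univ_inter, sub_zero,
    integral_maxKernelDet_Iio hw hH hp hb] at h
  rw [h, Nat.factorial_succ, mul_comm, ← integral_const_mul, ← integral_mul_const]
  refine integral_congr_ae (Eventually.of_forall fun y => ?_)
  have h1 : (n.factorial : ℂ) ≠ 0 := by exact_mod_cast n.factorial_ne_zero
  have h2 : (n : ℂ) + 1 ≠ 0 := by exact_mod_cast n.succ_ne_zero
  push_cast
  field_simp

end Ordering

/-! ### Integrals over half-lines as functions of the endpoint -/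

section HalfLine

variable {F : Type*} [NormedAddCommGroup F] [NormedSpace ℝ F]

theorem hasDerivAt_integral_Iio [CompleteSpace F] {h : ℝ → F} (hc : Continuous h)
    (hi : ∀ s, IntegrableOn h (Set.Iio s)) (t : ℝ) :
    HasDerivAt (fun s => ∫ x in Set.Iio s, h x) (h t) t := by
  have h1 : (fun s => ∫ x in Set.Iio s, h x) =
      fun s => (∫ x in Set.Iio t, h x) + ∫ x in t..s, h x := by
    ext s
    rw [← intervalIntegral.integral_Iio_sub_Iio' (hi s) (hi t)]
    abel
  rw [h1]
  exact (intervalIntegral.integral_hasDerivAt_right (hc.intervalIntegrable _ _)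
    (hc.stronglyMeasurableAtFilter _ _) hc.continuousAt).const_add _

theorem hasDerivAt_integral_Ioi [CompleteSpace F] {h : ℝ → F} (hc : Continuous h)
    (hi : ∀ s, IntegrableOn h (Set.Ioi s)) (t : ℝ) :
    HasDerivAt (fun s => ∫ x in Set.Ioi s, h x) (-h t) t := by
  have h1 : (fun s => ∫ x in Set.Ioi s, h x) =
      fun s => (∫ x in Set.Ioi t, h x) - ∫ x in t..s, h x := by
    ext s
    rw [← intervalIntegral.integral_Ioi_sub_Ioi' (hi t) (hi s)]
    abel
  rw [h1]
  exact (intervalIntegral.integral_hasDerivAt_right (hc.intervalIntegrable _ _)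
    (hc.stronglyMeasurableAtFilter _ _) hc.continuousAt).const_sub _

theorem tendsto_integral_Iio_atBot {h : ℝ → F} (hi : Integrable h) :
    Tendsto (fun s => ∫ x in Set.Iio s, h x) atBot (𝓝 0) := by
  have h1 : (fun s => ∫ x in Set.Iio s, h x) = fun s => (∫ x, h x) - ∫ x in Set.Ici s, h x := by
    ext s
    rw [← intervalIntegral.integral_Iio_add_Ici (b := s) hi.integrableOn hi.integrableOn]
    abel
  rw [h1]
  have := (aecover_Ici (μ := (volume : Measure ℝ)) (l := atBot)
    tendsto_id).integral_tendsto_of_countably_generated hi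
  simpa using this.const_sub (∫ x, h x)

end HalfLine

/-! ### The Jost solution as a Neumann series -/

section KaupNewell

/-- The weight `q̄(x) exp(2κx)`. -/
def jostWeight (q : 𝓢(ℝ, ℂ)) (κ : ℂ) (x : ℝ) : ℂ := conj (q x) * Complex.exp (2 * κ * x)

/-- The tail integral `∫_x^∞ q(y) exp(-2κy) dy`. -/
def jostTail (q : 𝓢(ℝ, ℂ)) (κ : ℂ) (x : ℝ) : ℂ :=
  ∫ y in Set.Ioi x, q y * Complex.exp (-(2 * κ * y))

/-- The `L¹` norm of a Schwartz function on the line. -/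
def normL1 (q : 𝓢(ℝ, ℂ)) : ℝ := ∫ x, ‖q x‖

variable (q : 𝓢(ℝ, ℂ)) {κ : ℂ}

theorem normL1_nonneg : 0 ≤ normL1 q := integral_nonneg fun _ => norm_nonneg _

theorem continuous_jostWeight : Continuous (jostWeight q κ) := by
  unfold jostWeight
  have := q.continuous
  fun_prop

theorem norm_jostWeight (x : ℝ) : ‖jostWeight q κ x‖ = ‖q x‖ * Real.exp (2 * κ.re * x) := by
  simp [jostWeight, Complex.norm_exp, mul_assoc]

theorem norm_tail_integrand (y : ℝ) :
    ‖q y * Complex.exp (-(2 * κ * y))‖ = ‖q y‖ * Real.exp (-(2 * κ.re * y)) := by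
  simp [Complex.norm_exp, mul_assoc]

theorem continuous_tail_integrand : Continuous fun y : ℝ => q y * Complex.exp (-(2 * κ * y)) := by
  have := q.continuous
  fun_prop

theorem integrableOn_tail_integrand (hκ : 0 < κ.re) (s : ℝ) :
    IntegrableOn (fun y : ℝ => q y * Complex.exp (-(2 * κ * y))) (Set.Ioi s) := by
  refine Integrable.mono' (g := fun y => ‖q y‖ * Real.exp (-(2 * κ.re * s)))
    (q.integrable.norm.integrableOn.mul_const _)
    (continuous_tail_integrand q).aestronglyMeasurable ?_
  refine ae_restrict_of_forall_mem measurableSet_Ioi fun y hy => ?_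
  rw [norm_tail_integrand]
  have : s < y := hy
  gcongr

theorem integrableOn_jostWeight_mul (hκ : 0 < κ.re) {g : ℝ → ℂ} (hg : Continuous g) {B : ℝ}
    (hB : ∀ x, ‖g x‖ ≤ B) (s : ℝ) :
    IntegrableOn (fun y : ℝ => jostWeight q κ y * g y) (Set.Iio s) := by
  refine Integrable.mono' (g := fun y => ‖q y‖ * Real.exp (2 * κ.re * s) * B)
    ((q.integrable.norm.integrableOn.mul_const _).mul_const _)
    ((continuous_jostWeight q).mul hg).aestronglyMeasurable ?_
  refine ae_restrict_of_forall_mem measurableSet_Iio fun y hy => ?_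
  rw [norm_mul, norm_jostWeight]
  have : y < s := hy
  gcongr
  exact hB y

theorem hasDerivAt_jostTail (hκ : 0 < κ.re) (x : ℝ) :
    HasDerivAt (jostTail q κ) (-(q x * Complex.exp (-(2 * κ * x)))) x :=
  hasDerivAt_integral_Ioi (continuous_tail_integrand q) (integrableOn_tail_integrand q hκ) x

theorem continuous_jostTail (hκ : 0 < κ.re) : Continuous (jostTail q κ) :=
  continuous_iff_continuousAt.2 fun x => (hasDerivAt_jostTail q hκ x).continuousAt

/-- The growth of `w` at `x` is compensated by the decay of the integrand of `H` to the right of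
`x`. -/
theorem norm_weight_mul_integral_le (hκ : 0 < κ.re) {x y : ℝ} (hxy : x ≤ y) {S : Set ℝ}
    (hS : MeasurableSet S) (hSy : S ⊆ Set.Ioi y) :
    ‖jostWeight q κ x * ∫ s in S, q s * Complex.exp (-(2 * κ * s))‖ ≤ normL1 q * ‖q x‖ := by
  have h1 : ‖∫ s in S, q s * Complex.exp (-(2 * κ * s))‖ ≤
      normL1 q * Real.exp (-(2 * κ.re * x)) := by
    calc _ ≤ ∫ s in S, ‖q s‖ * Real.exp (-(2 * κ.re * x)) := by
          refine norm_integral_le_of_norm_le (q.integrable.norm.integrableOn.mul_const _)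
            (ae_restrict_of_forall_mem hS fun s hs => ?_)
          rw [norm_tail_integrand]
          have : y < s := hSy hs
          have : x ≤ s := by linarith
          gcongr
      _ = (∫ s in S, ‖q s‖) * Real.exp (-(2 * κ.re * x)) := integral_mul_const _ _
      _ ≤ _ := by
          refine mul_le_mul_of_nonneg_right ?_ (Real.exp_nonneg _)
          exact setIntegral_le_integral q.integrable.norm
            (Eventually.of_forall fun _ => norm_nonneg _)
  rw [norm_mul, norm_jostWeight]
  refine (mul_le_mul_of_nonneg_left h1 (by positivity)).trans (le_of_eq ?_)
  rw [Real.exp_neg]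
  field_simp

theorem norm_weight_mul_tail_le (hκ : 0 < κ.re) {x y : ℝ} (hxy : x ≤ y) :
    ‖jostWeight q κ x * jostTail q κ y‖ ≤ normL1 q * ‖q x‖ :=
  norm_weight_mul_integral_le q hκ hxy measurableSet_Ioi subset_rfl

theorem norm_weight_mul_tail_sub_le (hκ : 0 < κ.re) {x y t : ℝ} (hxy : x ≤ y) (hyt : y ≤ t) :
    ‖jostWeight q κ x * (jostTail q κ y - jostTail q κ t)‖ ≤ normL1 q * ‖q x‖ := by
  have h : jostTail q κ y - jostTail q κ t =
      ∫ s in Set.Ioc y t, q s * Complex.exp (-(2 * κ * s)) := by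
    unfold jostTail
    rw [intervalIntegral.integral_Ioi_sub_Ioi (integrableOn_tail_integrand q hκ y) hyt,
      intervalIntegral.integral_of_le hyt]
  rw [h]
  exact norm_weight_mul_integral_le q hκ hxy measurableSet_Ioc Set.Ioc_subset_Ioi_self

/-- The Volterra operator `g ↦ ∫_{x < t} w(x) (H(x) - H(t)) g(x) dx` obtained by eliminating the
second component of the Kaup–Newell system. -/
def jostVolterra (q : 𝓢(ℝ, ℂ)) (κ : ℂ) (g : ℝ → ℂ) (t : ℝ) : ℂ :=
  ∫ x in Set.Iio t, jostWeight q κ x * (jostTail q κ x - jostTail q κ t) * g x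

theorem integrable_weight_mul_tail (hκ : 0 < κ.re) {g : ℝ → ℂ} (hg : Continuous g) {B : ℝ}
    (hB : ∀ x, ‖g x‖ ≤ B) :
    Integrable (fun y : ℝ => jostWeight q κ y * jostTail q κ y * g y) := by
  refine Integrable.mono' (g := fun y => normL1 q * ‖q y‖ * B)
    ((q.integrable.norm.const_mul _).mul_const _)
    (((continuous_jostWeight q).mul (continuous_jostTail q hκ)).mul hg).aestronglyMeasurable
    (Eventually.of_forall fun y => ?_)
  rw [norm_mul]
  exact mul_le_mul (norm_weight_mul_tail_le q hκ le_rfl) (hB y) (norm_nonneg _)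
    (mul_nonneg (normL1_nonneg q) (norm_nonneg _))

/-- Splitting the Volterra kernel; both halves converge by themselves because `w` decays at `-∞`. -/
theorem jostVolterra_eq (hκ : 0 < κ.re) {g : ℝ → ℂ} (hg : Continuous g) {B : ℝ}
    (hB : ∀ x, ‖g x‖ ≤ B) (t : ℝ) :
    jostVolterra q κ g t = (∫ x in Set.Iio t, jostWeight q κ x * jostTail q κ x * g x) -
      jostTail q κ t * ∫ x in Set.Iio t, jostWeight q κ x * g x := by
  unfold jostVolterra
  rw [← integral_const_mul, ← integral_sub (integrable_weight_mul_tail q hκ hg hB).integrableOn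
    ((integrableOn_jostWeight_mul q hκ hg hB t).const_mul _)]
  refine integral_congr_ae (Eventually.of_forall fun x => ?_)
  simp only
  ring

theorem hasDerivAt_jostVolterra (hκ : 0 < κ.re) {g : ℝ → ℂ} (hg : Continuous g) {B : ℝ}
    (hB : ∀ x, ‖g x‖ ≤ B) (t : ℝ) :
    HasDerivAt (jostVolterra q κ g)
      (q t * Complex.exp (-(2 * κ * t)) * ∫ x in Set.Iio t, jostWeight q κ x * g x) t := by
  rw [funext (jostVolterra_eq q hκ hg hB)]
  have h1 := hasDerivAt_integral_Iio
    (((continuous_jostWeight q).mul (continuous_jostTail q hκ)).mul hg)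
    (fun s => (integrable_weight_mul_tail q hκ hg hB).integrableOn) t
  have h2 := hasDerivAt_integral_Iio ((continuous_jostWeight q).mul hg)
    (fun s => integrableOn_jostWeight_mul q hκ hg hB s) t
  refine (h1.sub ((hasDerivAt_jostTail q hκ t).mul h2)).congr_deriv ?_
  simp only [Pi.mul_apply]
  ring

theorem orderedIntegral_succ_eq_jostVolterra (n : ℕ) :
    orderedIntegral (jostWeight q κ) (jostTail q κ) (n + 1) =
      jostVolterra q κ (orderedIntegral (jostWeight q κ) (jostTail q κ) n) := rfl

/-- The mass `∫_{-∞}^t |q|` of `q` to the left of `t`. -/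
def massLeft (q : 𝓢(ℝ, ℂ)) (t : ℝ) : ℝ := ∫ x in Set.Iio t, ‖q x‖

theorem hasDerivAt_massLeft (t : ℝ) : HasDerivAt (massLeft q) ‖q t‖ t :=
  hasDerivAt_integral_Iio q.continuous.norm (fun _ => q.integrable.norm.integrableOn) t

theorem continuous_massLeft : Continuous (massLeft q) :=
  continuous_iff_continuousAt.2 fun x => (hasDerivAt_massLeft q x).continuousAt

theorem massLeft_nonneg (t : ℝ) : 0 ≤ massLeft q t := integral_nonneg fun _ => norm_nonneg _

theorem massLeft_le (t : ℝ) : massLeft q t ≤ normL1 q :=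
  setIntegral_le_integral q.integrable.norm (Eventually.of_forall fun _ => norm_nonneg _)

theorem tendsto_massLeft_atBot : Tendsto (massLeft q) atBot (𝓝 0) :=
  tendsto_integral_Iio_atBot q.integrable.norm

theorem integral_massLeft_pow (n : ℕ) (t : ℝ) :
    ∫ x in Set.Iio t, massLeft q x ^ n * ‖q x‖ = massLeft q t ^ (n + 1) / (n + 1) := by
  have hn : (n : ℝ) + 1 ≠ 0 := by positivity
  have h1 : ∀ x ∈ Set.Iic t, HasDerivAt (fun x => massLeft q x ^ (n + 1) / (n + 1))
      (massLeft q x ^ n * ‖q x‖) x := by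
    intro x _
    refine (((hasDerivAt_massLeft q x).pow (n + 1)).div_const _).congr_deriv ?_
    push_cast
    field_simp
  have h2 : IntegrableOn (fun x => massLeft q x ^ n * ‖q x‖) (Set.Iic t) := by
    refine Integrable.mono' (g := fun x => normL1 q ^ n * ‖q x‖)
      (q.integrable.norm.integrableOn.const_mul _)
      (((continuous_massLeft q).pow n).mul q.continuous.norm).aestronglyMeasurable
      (Eventually.of_forall fun x => ?_)
    rw [Real.norm_of_nonneg (mul_nonneg (pow_nonneg (massLeft_nonneg q x) n) (norm_nonneg _))]
    have := massLeft_nonneg q x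
    have := massLeft_le q x
    gcongr
  have h3 : Tendsto (fun x => massLeft q x ^ (n + 1) / (n + 1)) atBot (𝓝 0) := by
    have := ((tendsto_massLeft_atBot q).pow (n + 1)).div_const ((n : ℝ) + 1)
    simpa using this
  rw [← integral_Iic_eq_integral_Iio, integral_Iic_of_hasDerivAt_of_tendsto' h1 h2 h3, sub_zero]

/-- The factorial in the bound for iterated Volterra integrals comes from
`d (massLeft ^ (n + 1)) = (n + 1) massLeft ^ n |q| dx`. -/
theorem orderedIntegral_bound (hκ : 0 < κ.re) (n : ℕ) :
    Continuous (orderedIntegral (jostWeight q κ) (jostTail q κ) n) ∧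
      ∀ t, ‖orderedIntegral (jostWeight q κ) (jostTail q κ) n t‖ ≤
        (normL1 q * massLeft q t) ^ n / n.factorial := by
  induction n with
  | zero =>
    constructor
    · exact continuous_const
    · intro t
      simp [orderedIntegral]
  | succ n ih =>
    obtain ⟨hc, hb⟩ := ih
    have hB : ∀ t, ‖orderedIntegral (jostWeight q κ) (jostTail q κ) n t‖ ≤
        (normL1 q * normL1 q) ^ n / n.factorial := fun t => by
      refine (hb t).trans ?_
      have := massLeft_nonneg q t
      have := massLeft_le q t
      have := normL1_nonneg q
      gcongr
    refine ⟨?_, fun t => ?_⟩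
    · rw [orderedIntegral_succ_eq_jostVolterra]
      exact continuous_iff_continuousAt.2 fun x =>
        (hasDerivAt_jostVolterra q hκ hc hB x).continuousAt
    · have hN := normL1_nonneg q
      rw [orderedIntegral]
      calc _ ≤ ∫ x in Set.Iio t, normL1 q ^ (n + 1) / n.factorial * (massLeft q x ^ n * ‖q x‖) := by
            refine norm_integral_le_of_norm_le ?_ (ae_restrict_of_forall_mem measurableSet_Iio
              fun x hx => ?_)
            · refine Integrable.const_mul ?_ _
              refine Integrable.mono' (g := fun x => normL1 q ^ n * ‖q x‖)
                (q.integrable.norm.integrableOn.const_mul _)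
                (((continuous_massLeft q).pow n).mul q.continuous.norm).aestronglyMeasurable
                (Eventually.of_forall fun x => ?_)
              rw [Real.norm_of_nonneg
                (mul_nonneg (pow_nonneg (massLeft_nonneg q x) n) (norm_nonneg _))]
              have := massLeft_nonneg q x
              have := massLeft_le q x
              gcongr
            · rw [norm_mul]
              refine (mul_le_mul (norm_weight_mul_tail_sub_le q hκ le_rfl (le_of_lt hx)) (hb x)
                (norm_nonneg _) (by positivity)).trans (le_of_eq ?_)
              rw [mul_pow]
              ring
        _ = _ := by
            rw [integral_const_mul, integral_massLeft_pow, Nat.factorial_succ, mul_pow]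
            push_cast
            field_simp

theorem norm_orderedIntegral_le (hκ : 0 < κ.re) (n : ℕ) (t : ℝ) :
    ‖orderedIntegral (jostWeight q κ) (jostTail q κ) n t‖ ≤
      (normL1 q * normL1 q) ^ n / n.factorial := by
  refine ((orderedIntegral_bound q hκ n).2 t).trans ?_
  have := massLeft_nonneg q t
  have := massLeft_le q t
  have := normL1_nonneg q
  gcongr

/-- The first component of the Jost solution, stripped of its exponential, as a Neumann series. -/
def jostSeries (q : 𝓢(ℝ, ℂ)) (κ k : ℂ) (t : ℝ) : ℂ :=
  ∑' n : ℕ, (-k) ^ n * orderedIntegral (jostWeight q κ) (jostTail q κ) n t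

variable (k : ℂ)

theorem norm_jostSeries_term_le (hκ : 0 < κ.re) (n : ℕ) (t : ℝ) :
    ‖(-k) ^ n * orderedIntegral (jostWeight q κ) (jostTail q κ) n t‖ ≤
      (‖k‖ * (normL1 q * normL1 q)) ^ n / n.factorial := by
  rw [norm_mul, norm_pow, norm_neg, mul_pow, mul_div_assoc]
  exact mul_le_mul_of_nonneg_left (norm_orderedIntegral_le q hκ n t) (by positivity)

theorem continuous_jostSeries (hκ : 0 < κ.re) : Continuous (jostSeries q κ k) :=
  continuous_tsum (fun n => continuous_const.mul (orderedIntegral_bound q hκ n).1)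
    (Real.summable_pow_div_factorial _) fun n t => norm_jostSeries_term_le q k hκ n t

theorem norm_jostSeries_le (hκ : 0 < κ.re) (t : ℝ) :
    ‖jostSeries q κ k t‖ ≤ ∑' n : ℕ, (‖k‖ * (normL1 q * normL1 q)) ^ n / n.factorial :=
  tsum_of_norm_bounded (Real.summable_pow_div_factorial _).hasSum fun n =>
    norm_jostSeries_term_le q k hκ n t

theorem summable_jostSeries (hκ : 0 < κ.re) (t : ℝ) :
    Summable fun n : ℕ => (-k) ^ n * orderedIntegral (jostWeight q κ) (jostTail q κ) n t :=
  Summable.of_norm_bounded (Real.summable_pow_div_factorial _) fun n =>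
    norm_jostSeries_term_le q k hκ n t

/-- Integrating the Neumann series term by term against a kernel dominated by `|q|`. -/
theorem hasSum_integral_jostSeries (hκ : 0 < κ.re) {f : ℝ → ℂ} {S : Set ℝ}
    (hS : MeasurableSet S) (hf : Continuous f)
    (hfb : ∀ x ∈ S, ‖f x‖ ≤ normL1 q * ‖q x‖) :
    HasSum (fun n : ℕ => (-k) ^ n *
        ∫ x in S, f x * orderedIntegral (jostWeight q κ) (jostTail q κ) n x)
      (∫ x in S, f x * jostSeries q κ k x) := by
  have hN := normL1_nonneg q
  have h := hasSum_integral_of_dominated_convergence (μ := volume.restrict S)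
    (F := fun (n : ℕ) x => (-k) ^ n * (f x * orderedIntegral (jostWeight q κ) (jostTail q κ) n x))
    (f := fun x => f x * jostSeries q κ k x)
    (fun n x => normL1 q * ‖q x‖ * ((‖k‖ * (normL1 q * normL1 q)) ^ n / n.factorial))
    (fun n => (continuous_const.mul
      (hf.mul (orderedIntegral_bound q hκ n).1)).aestronglyMeasurable)
    (fun n => ae_restrict_of_forall_mem hS fun x hx => ?_)
    (Eventually.of_forall fun x => (Real.summable_pow_div_factorial _).mul_left _) ?_
    (Eventually.of_forall fun x => ?_)
  · simpa only [integral_const_mul] using h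
  · rw [mul_left_comm, norm_mul]
    exact mul_le_mul (hfb x hx) (norm_jostSeries_term_le q k hκ n x) (norm_nonneg _)
      (by positivity)
  · simp_rw [tsum_mul_left]
    exact ((q.integrable.norm.const_mul _).mul_const _).integrableOn
  · have := (summable_jostSeries q k hκ x).hasSum.mul_left (f x)
    refine this.congr_fun ?_
    intro n
    ring

/-- The Volterra integral equation for the first component of the Jost solution. -/
theorem jostSeries_eq (hκ : 0 < κ.re) (t : ℝ) :
    jostSeries q κ k t = 1 - k * jostVolterra q κ (jostSeries q κ k) t := by
  have h := hasSum_integral_jostSeries q k hκ (S := Set.Iio t) measurableSet_Iio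
    (f := fun x => jostWeight q κ x * (jostTail q κ x - jostTail q κ t))
    ((continuous_jostWeight q).mul ((continuous_jostTail q hκ).sub continuous_const))
    (fun x hx => norm_weight_mul_tail_sub_le q hκ le_rfl (le_of_lt hx))
  have h1 := (summable_jostSeries q k hκ t).tsum_eq_zero_add
  rw [jostSeries, h1, pow_zero, one_mul, orderedIntegral, jostVolterra, ← h.tsum_eq,
    ← tsum_mul_left, sub_eq_add_neg, ← tsum_neg]
  congr 1
  refine tsum_congr fun n => ?_
  rw [orderedIntegral, pow_succ]
  ring

/-- The Neumann series, term by term, for the limit at `+∞` of the first component of the Jost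
solution. -/
theorem hasSum_scatteringCoeff (hκ : 0 < κ.re) :
    HasSum (fun n : ℕ => (-k) ^ n * ∫ x, jostWeight q κ x * jostTail q κ x *
        orderedIntegral (jostWeight q κ) (jostTail q κ) n x)
      (∫ x, jostWeight q κ x * jostTail q κ x * jostSeries q κ k x) := by
  have h := hasSum_integral_jostSeries q k hκ (S := Set.univ) MeasurableSet.univ
    (f := fun x => jostWeight q κ x * jostTail q κ x)
    ((continuous_jostWeight q).mul (continuous_jostTail q hκ))
    (fun x hx => norm_weight_mul_tail_le q hκ le_rfl)
  simpa using h

/-- The second component of the Jost solution, stripped of its exponential. -/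
def jostSecond (q : 𝓢(ℝ, ℂ)) (κ k lam : ℂ) (t : ℝ) : ℂ :=
  -lam * Complex.exp (-(2 * κ * t)) * ∫ x in Set.Iio t, jostWeight q κ x * jostSeries q κ k x

theorem hasDerivAt_jostSeries (hκ : 0 < κ.re) {lam : ℂ} (hlam : lam ^ 2 = k) (t : ℝ) :
    HasDerivAt (jostSeries q κ k) (lam * q t * jostSecond q κ k lam t) t := by
  rw [funext (jostSeries_eq q k hκ)]
  refine (((hasDerivAt_jostVolterra q hκ (continuous_jostSeries q k hκ)
    (norm_jostSeries_le q k hκ) t).const_mul k).const_sub 1).congr_deriv ?_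
  rw [jostSecond, ← hlam]
  ring

theorem hasDerivAt_jostSecond (hκ : 0 < κ.re) (lam : ℂ) (t : ℝ) :
    HasDerivAt (jostSecond q κ k lam)
      (-(2 * κ) * jostSecond q κ k lam t - lam * conj (q t) * jostSeries q κ k t) t := by
  have h1 := hasDerivAt_integral_Iio ((continuous_jostWeight q).mul (continuous_jostSeries q k hκ))
    (fun s => integrableOn_jostWeight_mul q hκ (continuous_jostSeries q k hκ)
      (norm_jostSeries_le q k hκ) s) t
  have h2 : HasDerivAt (fun t : ℝ => Complex.exp (-(2 * κ * t)))
      (Complex.exp (-(2 * κ * t)) * -(2 * κ * 1)) t :=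
    (((Complex.ofRealCLM.hasDerivAt (x := t)).const_mul (2 * κ)).neg).cexp
  refine ((h2.const_mul (-lam)).mul h1).congr_deriv ?_
  have h3 : Complex.exp (-(2 * κ * t)) * Complex.exp (2 * κ * t) = 1 := by
    rw [← Complex.exp_add]
    simp
  simp only [jostSecond, jostWeight, Pi.mul_apply]
  linear_combination (-lam * conj (q t) * jostSeries q κ k t) * h3

theorem tendsto_jostSeries_atBot (hκ : 0 < κ.re) :
    Tendsto (jostSeries q κ k) atBot (𝓝 1) := by
  set B := ∑' n : ℕ, (‖k‖ * (normL1 q * normL1 q)) ^ n / n.factorial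
  have hB0 : 0 ≤ B := tsum_nonneg fun n => by
    have := normL1_nonneg q
    positivity
  have h : Tendsto (fun t => jostVolterra q κ (jostSeries q κ k) t) atBot (𝓝 0) := by
    have hlim : Tendsto (fun t => normL1 q * B * massLeft q t) atBot (𝓝 0) := by
      simpa using (tendsto_massLeft_atBot q).const_mul (normL1 q * B)
    refine squeeze_zero_norm (fun t => ?_) hlim
    unfold jostVolterra massLeft
    rw [← integral_const_mul]
    refine norm_integral_le_of_norm_le (q.integrable.norm.integrableOn.const_mul _)
      (ae_restrict_of_forall_mem measurableSet_Iio fun x hx => ?_)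
    rw [norm_mul]
    refine (mul_le_mul (norm_weight_mul_tail_sub_le q hκ le_rfl (le_of_lt hx))
      (norm_jostSeries_le q k hκ x) (norm_nonneg _)
      (mul_nonneg (normL1_nonneg q) (norm_nonneg _))).trans (le_of_eq ?_)
    ring
  rw [funext (jostSeries_eq q k hκ)]
  simpa using (h.const_mul k).const_sub 1

theorem tendsto_jostSecond_atBot (hκ : 0 < κ.re) (lam : ℂ) :
    Tendsto (jostSecond q κ k lam) atBot (𝓝 0) := by
  set B := ∑' n : ℕ, (‖k‖ * (normL1 q * normL1 q)) ^ n / n.factorial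
  have hlim : Tendsto (fun t => ‖lam‖ * (B * massLeft q t)) atBot (𝓝 0) := by
    simpa using ((tendsto_massLeft_atBot q).const_mul B).const_mul ‖lam‖
  refine squeeze_zero_norm (fun t => ?_) hlim
  rw [jostSecond, mul_assoc, norm_mul, norm_neg]
  refine mul_le_mul_of_nonneg_left ?_ (norm_nonneg _)
  rw [← integral_const_mul]
  unfold massLeft
  rw [← integral_const_mul]
  refine norm_integral_le_of_norm_le (q.integrable.norm.integrableOn.const_mul _)
      (ae_restrict_of_forall_mem measurableSet_Iio fun x hx => ?_)
  have hxt : x < t := hx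
  rw [norm_mul, norm_mul, norm_jostWeight]
  have h1 : ‖Complex.exp (-(2 * κ * t))‖ = Real.exp (-(2 * κ.re * t)) := by
    simp [Complex.norm_exp, mul_assoc]
  have h2 : Real.exp (-(2 * κ.re * t)) * Real.exp (2 * κ.re * x) ≤ 1 := by
    rw [← Real.exp_add, Real.exp_le_one_iff]
    nlinarith
  have h3 := norm_jostSeries_le q k hκ x
  rw [h1]
  calc _ = (Real.exp (-(2 * κ.re * t)) * Real.exp (2 * κ.re * x)) *
        (‖jostSeries q κ k x‖ * ‖q x‖) := by ring
    _ ≤ 1 * (B * ‖q x‖) := by gcongr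
    _ = _ := one_mul _

/-- As `t → ∞` the tail `H(t)` vanishes, so that the Volterra kernel `w(x) (H(x) - H(t))` becomes
`w(x) H(x)`. -/
theorem tendsto_jostSeries_atTop (hκ : 0 < κ.re) :
    Tendsto (jostSeries q κ k) atTop
      (𝓝 (1 - k * ∫ x, jostWeight q κ x * jostTail q κ x * jostSeries q κ k x)) := by
  set B := ∑' n : ℕ, (‖k‖ * (normL1 q * normL1 q)) ^ n / n.factorial
  have htail : Tendsto (jostTail q κ) atTop (𝓝 0) := by
    have h0 := integrableOn_tail_integrand q hκ 0
    have h1 := intervalIntegral_tendsto_integral_Ioi 0 h0 tendsto_id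
    have h2 := h1.const_sub (∫ y in Set.Ioi (0 : ℝ), q y * Complex.exp (-(2 * κ * y)))
    rw [sub_self] at h2
    refine h2.congr fun t => ?_
    rw [id, ← intervalIntegral.integral_Ioi_sub_Ioi' h0 (integrableOn_tail_integrand q hκ t)]
    simp [jostTail]
  have h : Tendsto (fun t => jostVolterra q κ (jostSeries q κ k) t) atTop
      (𝓝 (∫ x, jostWeight q κ x * jostTail q κ x * jostSeries q κ k x)) := by
    unfold jostVolterra
    simp_rw [← integral_indicator measurableSet_Iio]
    refine tendsto_integral_filter_of_dominated_convergence (fun x => normL1 q * ‖q x‖ * B)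
      (Eventually.of_forall fun t => ?_) (Eventually.of_forall fun t =>
        Eventually.of_forall fun x => ?_) ((q.integrable.norm.const_mul _).mul_const _)
      (Eventually.of_forall fun x => ?_)
    · refine AEStronglyMeasurable.indicator ?_ measurableSet_Iio
      exact (((continuous_jostWeight q).mul ((continuous_jostTail q hκ).sub continuous_const)).mul
        (continuous_jostSeries q k hκ)).aestronglyMeasurable
    · have hnn : 0 ≤ normL1 q * ‖q x‖ := mul_nonneg (normL1_nonneg q) (norm_nonneg _)
      by_cases hx : x ∈ Set.Iio t
      · rw [Set.indicator_of_mem hx, norm_mul]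
        exact mul_le_mul (norm_weight_mul_tail_sub_le q hκ le_rfl (le_of_lt hx))
          (norm_jostSeries_le q k hκ x) (norm_nonneg _) hnn
      · rw [Set.indicator_of_notMem hx, norm_zero]
        exact mul_nonneg hnn ((norm_nonneg _).trans (norm_jostSeries_le q k hκ x))
    · have hx : Tendsto (fun t => jostWeight q κ x * (jostTail q κ x - jostTail q κ t) *
          jostSeries q κ k x) atTop (𝓝 (jostWeight q κ x * (jostTail q κ x - 0) *
          jostSeries q κ k x)) := ((htail.const_sub _).const_mul _).mul_const _
      rw [sub_zero] at hx
      refine hx.congr' ?_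
      filter_upwards [eventually_gt_atTop x] with t ht
      rw [Set.indicator_of_mem (Set.mem_Iio.2 ht)]
  exact ((h.const_mul k).const_sub 1).congr fun t => (jostSeries_eq q k hκ t).symm

end KaupNewell

/-! ### Existence and uniqueness of the Jost solution -/

section Jost

variable (q : 𝓢(ℝ, ℂ)) {k lam : ℂ}

/-- A solution of the Kaup–Newell system that is `o(exp (-i lam² x))` at `-∞` vanishes:
with `(U, V) = exp (i lam² x) φ`, the quantity
`(|U|² + |V|²) exp (-2 |lam| ∫_{-∞}^x |q|)` is nonincreasing because `Im lam² > 0`, and tends to `0`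
at `-∞`. -/
theorem SolvesKaupNewell.eq_zero (hk : 0 < k.im) (hlam : lam ^ 2 = k) {φ : ℝ → Fin 2 → ℂ}
    (hφ : SolvesKaupNewell lam q φ)
    (hlim : Tendsto (fun x : ℝ => Complex.exp (Complex.I * lam ^ 2 * x) • φ x) atBot (𝓝 0)) :
    φ = 0 := by
  have hexp : ∀ x : ℝ, HasDerivAt (fun x : ℝ => Complex.exp (Complex.I * lam ^ 2 * x))
      (Complex.exp (Complex.I * lam ^ 2 * x) * (Complex.I * lam ^ 2 * 1)) x := fun x =>
    ((Complex.ofRealCLM.hasDerivAt (x := x)).const_mul (Complex.I * lam ^ 2)).cexp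
  set U : ℝ → ℂ := fun x => Complex.exp (Complex.I * lam ^ 2 * x) * φ x 0 with hU
  set V : ℝ → ℂ := fun x => Complex.exp (Complex.I * lam ^ 2 * x) * φ x 1 with hV
  have hφ0 : ∀ x, HasDerivAt (fun x => φ x 0)
      (-Complex.I * lam ^ 2 * φ x 0 + lam * q x * φ x 1) x := by
    intro x
    refine (hasDerivAt_pi.1 (hφ x) 0).congr_deriv ?_
    simp [Matrix.mulVec, dotProduct, Fin.sum_univ_two]
  have hφ1 : ∀ x, HasDerivAt (fun x => φ x 1)
      (-lam * conj (q x) * φ x 0 + Complex.I * lam ^ 2 * φ x 1) x := by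
    intro x
    refine (hasDerivAt_pi.1 (hφ x) 1).congr_deriv ?_
    simp [Matrix.mulVec, dotProduct, Fin.sum_univ_two]
  have hU' : ∀ x, HasDerivAt U (lam * q x * V x) x := fun x => by
    refine ((hexp x).mul (hφ0 x)).congr_deriv ?_
    simp only [hV]
    ring
  have hV' : ∀ x, HasDerivAt V (2 * Complex.I * k * V x - lam * conj (q x) * U x) x := fun x => by
    refine ((hexp x).mul (hφ1 x)).congr_deriv ?_
    simp only [hU, hV, ← hlam]
    ring
  set E : ℝ → ℝ := fun x => ‖U x‖ ^ 2 + ‖V x‖ ^ 2 with hE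
  have hE' : ∀ x, HasDerivAt E (2 * inner ℝ (U x) (lam * q x * V x) +
      2 * inner ℝ (V x) (2 * Complex.I * k * V x - lam * conj (q x) * U x)) x := fun x =>
    (hU' x).norm_sq.add (hV' x).norm_sq
  have hEbd : ∀ x, 2 * inner ℝ (U x) (lam * q x * V x) +
      2 * inner ℝ (V x) (2 * Complex.I * k * V x - lam * conj (q x) * U x) ≤
      2 * ‖lam‖ * ‖q x‖ * E x := by
    intro x
    have h1 : inner ℝ (U x) (lam * q x * V x) ≤ ‖U x‖ * (‖lam‖ * ‖q x‖ * ‖V x‖) := by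
      refine (real_inner_le_norm _ _).trans (le_of_eq ?_)
      simp
    have h2 : -inner ℝ (V x) (lam * conj (q x) * U x) ≤ ‖V x‖ * (‖lam‖ * ‖q x‖ * ‖U x‖) := by
      rw [← inner_neg_right]
      refine (real_inner_le_norm _ _).trans (le_of_eq ?_)
      simp
    have h3 : inner ℝ (V x) (2 * Complex.I * k * V x) ≤ 0 := by
      have : inner ℝ (V x) (2 * Complex.I * k * V x) = -2 * k.im * Complex.normSq (V x) := by
        rw [Complex.inner, Complex.normSq_apply]
        simp
        ring
      rw [this]
      have := Complex.normSq_nonneg (V x)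
      nlinarith [mul_nonneg hk.le this]
    rw [inner_sub_right]
    have h4 : 0 ≤ ‖lam‖ * ‖q x‖ := by positivity
    have h5 : 2 * ‖U x‖ * ‖V x‖ ≤ E x := two_mul_le_add_sq _ _
    have h6 := mul_le_mul_of_nonneg_left h5 h4
    nlinarith
  set Φ : ℝ → ℝ := fun x => 2 * ‖lam‖ * massLeft q x with hΦ
  have hΦ' : ∀ x, HasDerivAt Φ (2 * ‖lam‖ * ‖q x‖) x := fun x =>
    (hasDerivAt_massLeft q x).const_mul _
  have hm' : ∀ x, HasDerivAt (fun x => E x * Real.exp (-Φ x))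
      ((2 * inner ℝ (U x) (lam * q x * V x) +
      2 * inner ℝ (V x) (2 * Complex.I * k * V x - lam * conj (q x) * U x)) * Real.exp (-Φ x) +
      E x * (Real.exp (-Φ x) * -(2 * ‖lam‖ * ‖q x‖))) x := fun x =>
    (hE' x).mul (hΦ' x).neg.exp
  have hanti : Antitone fun x => E x * Real.exp (-Φ x) := by
    refine antitone_of_hasDerivAt_nonpos hm' fun x => ?_
    have h1 := mul_le_mul_of_nonneg_right (hEbd x) (Real.exp_nonneg (-Φ x))
    simp only [Pi.zero_apply]
    linarith
  have hUlim : Tendsto U atBot (𝓝 0) := by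
    have := (tendsto_pi_nhds.1 hlim) 0
    simpa [hU] using this
  have hVlim : Tendsto V atBot (𝓝 0) := by
    have := (tendsto_pi_nhds.1 hlim) 1
    simpa [hV] using this
  have hElim : Tendsto E atBot (𝓝 0) := by
    have := (hUlim.norm.pow 2).add (hVlim.norm.pow 2)
    simpa using this
  have hmlim : Tendsto (fun x => E x * Real.exp (-Φ x)) atBot (𝓝 0) := by
    have h1 : Tendsto (fun x => Real.exp (-Φ x)) atBot (𝓝 (Real.exp (-(2 * ‖lam‖ * 0)))) :=
      (Real.continuous_exp.tendsto _).comp (((tendsto_massLeft_atBot q).const_mul _).neg)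
    simpa using hElim.mul h1
  funext x
  have hx : E x * Real.exp (-Φ x) ≤ 0 := by
    refine ge_of_tendsto hmlim ?_
    filter_upwards [eventually_le_atBot x] with y hy
    exact hanti hy
  have hEx : E x ≤ 0 := by
    by_contra hcon
    push Not at hcon
    exact absurd hx (not_le.2 (mul_pos hcon (Real.exp_pos _)))
  have hUx : ‖U x‖ = 0 := by
    have := norm_nonneg (U x)
    simp only [hE] at hEx
    nlinarith [sq_nonneg ‖V x‖]
  have hVx : ‖V x‖ = 0 := by
    have := norm_nonneg (V x)
    simp only [hE] at hEx
    nlinarith [sq_nonneg ‖U x‖]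
  have h0 : φ x 0 = 0 := by simpa [hU, Complex.exp_ne_zero] using hUx
  have h1 : φ x 1 = 0 := by simpa [hV, Complex.exp_ne_zero] using hVx
  funext i
  fin_cases i
  · exact h0
  · exact h1

theorem IsJostSolution.unique (hk : 0 < k.im) (hlam : lam ^ 2 = k) {φ ψ : ℝ → Fin 2 → ℂ}
    (hφ : IsJostSolution lam q φ) (hψ : IsJostSolution lam q ψ) : φ = ψ := by
  rw [← sub_eq_zero]
  refine SolvesKaupNewell.eq_zero q hk hlam (fun x => ?_) ?_
  · have := (hφ.1 x).sub (hψ.1 x)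
    rwa [← Matrix.mulVec_sub] at this
  · have := hφ.2.sub hψ.2
    simpa [smul_sub] using this

/-- The Neumann series solves the Kaup–Newell system and gives the scattering coefficient. -/
theorem hasScatteringCoeff_of_im_pos (hk : 0 < k.im) (hlam : lam ^ 2 = k) :
    HasScatteringCoeff lam q (1 - k * ∫ x, jostWeight q (k / Complex.I) x *
      jostTail q (k / Complex.I) x * jostSeries q (k / Complex.I) k x) := by
  set κ := k / Complex.I with hκdef
  have hκ : 0 < κ.re := by
    rw [hκdef]
    simpa [Complex.div_I] using hk
  have hκk : Complex.I * k = -κ := by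
    rw [hκdef, Complex.div_I]
    ring
  set ψ : ℝ → Fin 2 → ℂ := fun x => Complex.exp (κ * x) •
    ![jostSeries q κ k x, jostSecond q κ k lam x] with hψ
  have hone : ∀ x : ℝ, Complex.exp (Complex.I * lam ^ 2 * x) * Complex.exp (κ * x) = 1 := by
    intro x
    rw [hlam, hκk, ← Complex.exp_add]
    simp
  have hexp : ∀ x : ℝ, HasDerivAt (fun x : ℝ => Complex.exp (κ * x))
      (Complex.exp (κ * x) * (κ * 1)) x := fun x =>
    ((Complex.ofRealCLM.hasDerivAt (x := x)).const_mul κ).cexp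
  have hJ : IsJostSolution lam q ψ := by
    constructor
    · intro x
      have hkI : -Complex.I * lam ^ 2 = κ := by rw [hlam, neg_mul, hκk, neg_neg]
      have hkI' : Complex.I * lam ^ 2 = -κ := by rw [hlam, hκk]
      rw [hasDerivAt_pi]
      intro i
      fin_cases i
      · refine ((hexp x).mul (hasDerivAt_jostSeries q k hκ hlam x)).congr_deriv ?_
        simp [hψ, Matrix.mulVec, dotProduct, Fin.sum_univ_two, hkI']
        ring
      · refine ((hexp x).mul (hasDerivAt_jostSecond q k hκ lam x)).congr_deriv ?_
        simp [hψ, Matrix.mulVec, dotProduct, Fin.sum_univ_two, hkI']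
        ring
    · simp only [hψ, smul_smul, hone, one_smul]
      rw [tendsto_pi_nhds]
      intro i
      fin_cases i
      · simpa using tendsto_jostSeries_atBot q k hκ
      · simpa using tendsto_jostSecond_atBot q k hκ lam
  refine ⟨ψ, hJ, fun φ hφ => IsJostSolution.unique q hk hlam hφ hJ, ?_⟩
  refine (tendsto_jostSeries_atTop q k hκ).congr fun x => ?_
  simp only [hψ, Pi.smul_apply, smul_eq_mul, Matrix.cons_val_zero]
  rw [← mul_assoc, hone, one_mul]

end Jost

/-! ### The Fourier transform and Fourier multipliers on `L²(ℝ)` -/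

section FourierL2

open scoped FourierTransform

/-- The Fourier transform on `L²(ℝ)`. -/
abbrev fourierL2 : L2R ≃ₗᵢ[ℂ] L2R := Lp.fourierTransformₗᵢ ℝ ℂ

theorem coeFn_mulOp (m : ℝ → ℂ) (hm : MemLp m ∞ (volume : Measure ℝ)) (f : L2R) :
    mulOp m hm f =ᵐ[volume] fun x => m x * f x := by
  have h1 := (ContinuousLinearMap.mul ℂ ℂ).coeFn_holder (r := 2) (hm.toLp m) f
  filter_upwards [h1, hm.coeFn_toLp] with x hx hx'
  rw [hx'] at hx
  exact hx

theorem fourierL2_fourierMul (m : ℝ → ℂ) (hm : MemLp m ∞ (volume : Measure ℝ)) (f : L2R) :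
    fourierL2 (fourierMul m hm f) = mulOp m hm (fourierL2 f) :=
  fourierL2.apply_symm_apply _

theorem inner_L2R (f g : L2R) : inner ℂ f g = ∫ x, conj (f x) * g x := by
  rw [L2.inner_def]
  refine integral_congr_ae (Eventually.of_forall fun x => ?_)
  simp [mul_comm]

theorem inner_mulOp_left (m : ℝ → ℂ) (hm : MemLp m ∞ (volume : Measure ℝ))
    (hm' : MemLp (fun x => conj (m x)) ∞ (volume : Measure ℝ)) (f g : L2R) :
    inner ℂ (mulOp (fun x => conj (m x)) hm' f) g = inner ℂ f (mulOp m hm g) := by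
  rw [inner_L2R, inner_L2R]
  refine integral_congr_ae ?_
  filter_upwards [coeFn_mulOp m hm g, coeFn_mulOp _ hm' f] with x h1 h2
  rw [h1, h2, map_mul, Complex.conj_conj]
  ring

theorem adjoint_mulOp (m : ℝ → ℂ) (hm : MemLp m ∞ (volume : Measure ℝ))
    (hm' : MemLp (fun x => conj (m x)) ∞ (volume : Measure ℝ)) :
    ContinuousLinearMap.adjoint (mulOp m hm) = mulOp (fun x => conj (m x)) hm' := by
  symm
  rw [ContinuousLinearMap.eq_adjoint_iff]
  exact inner_mulOp_left m hm hm'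

theorem adjoint_fourierMul (m : ℝ → ℂ) (hm : MemLp m ∞ (volume : Measure ℝ))
    (hm' : MemLp (fun x => conj (m x)) ∞ (volume : Measure ℝ)) :
    ContinuousLinearMap.adjoint (fourierMul m hm) = fourierMul (fun x => conj (m x)) hm' := by
  symm
  rw [ContinuousLinearMap.eq_adjoint_iff]
  intro f g
  rw [← fourierL2.inner_map_map, ← fourierL2.inner_map_map f, fourierL2_fourierMul,
    fourierL2_fourierMul, inner_mulOp_left]

theorem norm_sq_L2R (f : L2R) : ‖f‖ ^ 2 = ∫ x, ‖f x‖ ^ 2 := by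
  have h := inner_self_eq_norm_sq_to_K (𝕜 := ℂ) f
  rw [inner_L2R] at h
  have h2 : ∀ x, conj (f x) * f x = ((‖f x‖ ^ 2 : ℝ) : ℂ) := fun x => by
    rw [Complex.conj_mul']
    push_cast
    rfl
  simp_rw [h2] at h
  rw [integral_complex_ofReal] at h
  exact Complex.ofReal_injective (by simpa using h.symm)

theorem integrable_norm_sq_L2R (f : L2R) : Integrable fun x => ‖f x‖ ^ 2 :=
  (memLp_two_iff_integrable_sq_norm (Lp.memLp f).1).1 (Lp.memLp f)

theorem continuous_fourier_of_integrable {f : ℝ → ℂ} (h : Integrable f) : Continuous (𝓕 f) :=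
  VectorFourier.fourierIntegral_continuous Real.continuous_fourierChar
    (by exact continuous_inner) h

/-- On `L¹ ∩ L²` the Fourier transform on `L²` is the Fourier integral. Both are determined by
duality against test functions. -/
theorem coeFn_fourierL2_toLp {f : ℝ → ℂ} (h1 : Integrable f) (h2 : MemLp f 2 volume) :
    fourierL2 (h2.toLp f) =ᵐ[volume] 𝓕 f := by
  have hloc : LocallyIntegrable (fourierL2 (h2.toLp f) : ℝ → ℂ) volume :=
    (Lp.memLp _).locallyIntegrable (by norm_num)
  have hcont : Continuous (𝓕 f) := continuous_fourier_of_integrable h1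
  refine ae_eq_of_integral_contDiff_smul_eq hloc hcont.locallyIntegrable fun g hg hgs => ?_
  have hgs' : HasCompactSupport (fun x => (g x : ℂ)) :=
    hgs.comp_left (g := fun y : ℝ => (y : ℂ)) rfl
  have hg' : ContDiff ℝ (⊤ : ℕ∞) (fun x => (g x : ℂ)) := Complex.ofRealCLM.contDiff.comp hg
  set φ : 𝓢(ℝ, ℂ) := hgs'.toSchwartzMap hg' with hφ
  have hφx : ∀ x, φ x = (g x : ℂ) := fun x => rfl
  have h3 := congrArg (fun T => T φ) (Lp.fourier_toTemperedDistribution_eq (h2.toLp f))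
  simp only [TemperedDistribution.fourier_apply, Lp.toTemperedDistribution_apply] at h3
  have h4 : ∫ x, g x • (fourierL2 (h2.toLp f)) x = ∫ x, φ x • (𝓕 (h2.toLp f) : L2R) x := by
    refine integral_congr_ae (Eventually.of_forall fun x => ?_)
    simp only [hφx, Complex.real_smul, smul_eq_mul]
    rfl
  have h5 : ∫ x, (𝓕 φ) x • (h2.toLp f) x = ∫ x, (𝓕 φ) x • f x := by
    refine integral_congr_ae ?_
    filter_upwards [h2.coeFn_toLp] with x hx
    rw [hx]
  -- The multiplication formula for the Fourier integral.
  have h6 : ∫ x, (𝓕 φ) x • f x = ∫ x, φ x • 𝓕 f x := by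
    have := VectorFourier.integral_fourierIntegral_smul_eq_flip (μ := volume) (ν := volume)
      (L := innerₗ ℝ) Real.continuous_fourierChar (by exact continuous_inner) φ.integrable h1
    rw [flip_innerₗ] at this
    exact this
  rw [h4, ← h3, h5, h6]
  refine integral_congr_ae (Eventually.of_forall fun x => ?_)
  simp only [hφx, Complex.real_smul, smul_eq_mul]

/-- The modulated function `x ↦ exp (2πixη) p(x)` as an element of `L²(ℝ)`. -/
def modulate (p : ℝ → ℂ) (hp : MemLp p 2 (volume : Measure ℝ)) (η : ℝ) : L2R :=
  MemLp.toLp (fun x : ℝ => Complex.exp (2 * Real.pi * x * η * Complex.I) * p x)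
    (hp.of_le (f := fun x : ℝ => Complex.exp (2 * Real.pi * x * η * Complex.I) * p x)
      ((Continuous.aestronglyMeasurable (by fun_prop)).mul hp.1)
      (Eventually.of_forall fun x => by
        rw [norm_mul, show (2 * Real.pi * x * η * Complex.I : ℂ) =
          ((2 * Real.pi * x * η : ℝ) : ℂ) * Complex.I by push_cast; ring,
          Complex.norm_exp_ofReal_mul_I, one_mul]))

theorem coeFn_modulate (p : ℝ → ℂ) (hp : MemLp p 2 (volume : Measure ℝ)) (η : ℝ) :
    modulate p hp η =ᵐ[volume] fun x : ℝ => Complex.exp (2 * Real.pi * x * η * Complex.I) * p x :=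
  MemLp.coeFn_toLp _

theorem norm_cexp_modulation (x η : ℝ) : ‖Complex.exp (2 * Real.pi * x * η * Complex.I)‖ = 1 := by
  rw [show (2 * Real.pi * x * η * Complex.I : ℂ) =
    ((2 * Real.pi * x * η : ℝ) : ℂ) * Complex.I by push_cast; ring, Complex.norm_exp_ofReal_mul_I]

theorem fourier_real_eq (f : ℝ → ℂ) (η : ℝ) :
    𝓕 f η = ∫ x : ℝ, Complex.exp (-(2 * Real.pi * x * η * Complex.I)) * f x := by
  rw [Real.fourier_real_eq_integral_exp_smul]
  refine integral_congr_ae (Eventually.of_forall fun x => ?_)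
  simp only [smul_eq_mul]
  congr 2
  push_cast
  ring

theorem conj_cexp_modulation (x η : ℝ) :
    conj (Complex.exp (2 * Real.pi * x * η * Complex.I)) =
      Complex.exp (-(2 * Real.pi * x * η * Complex.I)) := by
  rw [← Complex.exp_conj]
  congr 1
  simp [map_ofNat]

/-- The Fourier transform of `p̄ R` is given by inner products with the modulations of `p`. -/
theorem fourierL2_mulOp_conj (p : ℝ → ℂ) (hp : MemLp p 2 (volume : Measure ℝ))
    (hp' : MemLp (fun x => conj (p x)) ∞ (volume : Measure ℝ)) (R : L2R) :
    fourierL2 (mulOp (fun x => conj (p x)) hp' R) =ᵐ[volume]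
      fun η => inner ℂ (modulate p hp η) R := by
  set f : ℝ → ℂ := fun x => conj (p x) * R x with hf
  have h1 : Integrable f := hp.star.integrable_mul (Lp.memLp R)
  have h2 : MemLp f 2 volume :=
    (memLp_congr_ae (coeFn_mulOp _ hp' R)).1 (Lp.memLp _)
  have h3 : mulOp (fun x => conj (p x)) hp' R = h2.toLp f := by
    refine Lp.ext ?_
    filter_upwards [coeFn_mulOp _ hp' R, h2.coeFn_toLp] with x hx hx'
    rw [hx, hx']
  rw [h3]
  filter_upwards [coeFn_fourierL2_toLp h1 h2] with η hη
  rw [hη, fourier_real_eq, inner_L2R]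
  refine integral_congr_ae ?_
  filter_upwards [coeFn_modulate p hp η] with x hx
  rw [hx, map_mul, conj_cexp_modulation, hf]
  ring

theorem fourierL2_modulate (p : ℝ → ℂ) (hp1 : Integrable p) (hp : MemLp p 2 (volume : Measure ℝ))
    (η : ℝ) : fourierL2 (modulate p hp η) =ᵐ[volume] fun ξ => 𝓕 p (ξ - η) := by
  have h1 : Integrable fun x : ℝ => Complex.exp (2 * Real.pi * x * η * Complex.I) * p x := by
    refine hp1.mono ((Continuous.aestronglyMeasurable (by fun_prop)).mul hp1.1)
      (Eventually.of_forall fun x => ?_)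
    rw [norm_mul, norm_cexp_modulation, one_mul]
  filter_upwards [coeFn_fourierL2_toLp h1 (MemLp.ae_eq (coeFn_modulate p hp η) (Lp.memLp _))]
    with ξ hξ
  refine hξ.trans ?_
  rw [fourier_real_eq, fourier_real_eq]
  refine integral_congr_ae (Eventually.of_forall fun x => ?_)
  simp only
  rw [← mul_assoc, ← Complex.exp_add]
  congr 2
  push_cast
  ring

theorem norm_sq_fourierMul_modulate (p : ℝ → ℂ) (hp1 : Integrable p)
    (hp : MemLp p 2 (volume : Measure ℝ)) (m : ℝ → ℂ) (hm : MemLp m ∞ (volume : Measure ℝ))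
    (η : ℝ) : ‖fourierMul m hm (modulate p hp η)‖ ^ 2 = ∫ ξ, ‖m ξ‖ ^ 2 * ‖𝓕 p (ξ - η)‖ ^ 2 := by
  rw [← fourierL2.norm_map, fourierL2_fourierMul, norm_sq_L2R]
  refine integral_congr_ae ?_
  filter_upwards [coeFn_mulOp m hm (fourierL2 (modulate p hp η)), fourierL2_modulate p hp1 hp η]
    with ξ h1 h2
  rw [h1, h2, norm_mul, mul_pow]

theorem integrable_norm_sq_fourier (p : ℝ → ℂ) (hp1 : Integrable p)
    (hp : MemLp p 2 (volume : Measure ℝ)) : Integrable fun ξ => ‖𝓕 p ξ‖ ^ 2 := by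
  refine (integrable_norm_sq_L2R (fourierL2 (hp.toLp p))).congr ?_
  filter_upwards [coeFn_fourierL2_toLp hp1 hp] with ξ hξ
  rw [hξ]

/-- The matrix elements of modulations are continuous in the frequency. -/
theorem continuous_inner_modulate (p : ℝ → ℂ) (hp : MemLp p 2 (volume : Measure ℝ)) (R : L2R) :
    Continuous fun η => inner ℂ (modulate p hp η) R := by
  have h1 : Integrable fun x => conj (p x) * R x := hp.star.integrable_mul (Lp.memLp R)
  refine (continuous_fourier_of_integrable h1).congr fun η => ?_
  rw [fourier_real_eq, inner_L2R]
  refine integral_congr_ae ?_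
  filter_upwards [coeFn_modulate p hp η] with x hx
  rw [hx, map_mul, conj_cexp_modulation]
  ring

/-- `a(η) b(ξ) Q(ξ - η)` is integrable for `a, b ∈ L²` and `0 ≤ Q ∈ L¹`: the product `a b` is
dominated by `a² + b²`, and each square is convolved with `Q` separately. -/
theorem integrable_symbol_prod {a b Q : ℝ → ℝ} (ha : Integrable fun η => a η ^ 2)
    (hb : Integrable fun ξ => b ξ ^ 2) (ham : Continuous a) (hbm : Continuous b)
    (hQ : Integrable Q) (hQ0 : ∀ x, 0 ≤ Q x) (hQm : Continuous Q) :
    Integrable (fun z : ℝ × ℝ => a z.2 * (b z.1 * Q (z.1 - z.2))) (volume.prod volume) := by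
  have h1 : Integrable (fun z : ℝ × ℝ => a z.2 ^ 2 * Q (z.1 - z.2)) (volume.prod volume) :=
    ha.convolution_integrand (ContinuousLinearMap.mul ℝ ℝ) hQ
  have h2 : Integrable (fun z : ℝ × ℝ => b z.2 ^ 2 * Q (-(z.1 - z.2))) (volume.prod volume) :=
    hb.convolution_integrand (ContinuousLinearMap.mul ℝ ℝ) hQ.comp_neg
  refine (h1.add h2.swap).mono' (Continuous.aestronglyMeasurable (by fun_prop))
    (Eventually.of_forall fun z => ?_)
  have hq := hQ0 (z.1 - z.2)
  simp only [Pi.add_apply, Function.comp_apply, Prod.fst_swap, Prod.snd_swap, neg_sub]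
  rw [← mul_assoc, norm_mul, Real.norm_of_nonneg hq, ← add_mul]
  refine mul_le_mul_of_nonneg_right ?_ hq
  rw [Real.norm_eq_abs, abs_le]
  constructor <;> nlinarith [sq_nonneg (a z.2 + b z.1), sq_nonneg (a z.2 - b z.1)]

theorem integrable_inv_norm_sq {κ : ℂ} (hκ : 0 < κ.re) {σ : ℝ} (hσ : σ ≠ 0) :
    Integrable fun ξ : ℝ => (‖κ + σ * (2 * Real.pi * Complex.I * ξ)‖⁻¹) ^ 2 := by
  have h0 : κ.re ≠ 0 := hκ.ne'
  have h1 := ((integrable_inv_one_add_sq.comp_add_right (κ.im / κ.re)).comp_mul_left'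
    (R := σ * 2 * Real.pi / κ.re) (by positivity)).const_mul ((κ.re ^ 2)⁻¹)
  refine h1.congr (Eventually.of_forall fun ξ => ?_)
  simp only
  rw [inv_pow, ← Complex.normSq_eq_norm_sq, Complex.normSq_apply, ← mul_inv]
  congr 1
  simp
  field_simp
  ring

end FourierL2

/-! ### Hilbert–Schmidt and trace class operators -/

section HilbertSchmidt

variable {E ι : Type*} [NormedAddCommGroup E] [InnerProductSpace ℂ E]

theorem HilbertBasis.hasSum_norm_inner_sq (b : HilbertBasis ι ℂ E) (x : E) :
    HasSum (fun i => ‖inner ℂ (b i) x‖ ^ 2) (‖x‖ ^ 2) := by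
  have h := b.hasSum_inner_mul_inner x x
  have hx : inner ℂ x x = ((‖x‖ ^ 2 : ℝ) : ℂ) := by simp [inner_self_eq_norm_sq_to_K]
  rw [hx] at h
  have h2 : ∀ i, inner ℂ x (b i) * inner ℂ (b i) x = ((‖inner ℂ (b i) x‖ ^ 2 : ℝ) : ℂ) := by
    intro i
    rw [← inner_conj_symm, Complex.conj_mul']
    push_cast
    rfl
  simp_rw [h2] at h
  exact Complex.hasSum_ofReal.1 h

theorem HilbertBasis.countable_index [SecondCountableTopology E] (b : HilbertBasis ι ℂ E) :
    Countable ι := by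
  rw [← Set.countable_univ_iff]
  refine Set.PairwiseDisjoint.countable_of_isOpen (s := fun i => Metric.ball (b i) (1 / 2)) ?_
    (fun i _ => Metric.isOpen_ball) (fun i _ => ⟨b i, Metric.mem_ball_self (by norm_num)⟩)
  intro i _ j _ hij
  refine Metric.ball_disjoint_ball ?_
  have h1 : ‖b i - b j‖ ^ 2 = 2 := by
    rw [@norm_sub_sq ℂ, b.orthonormal.1 i, b.orthonormal.1 j, b.orthonormal.2 hij]
    norm_num
  rw [dist_eq_norm]
  nlinarith [norm_nonneg (b i - b j)]

variable [CompleteSpace E]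

/-- The adjoint of a Hilbert–Schmidt operator is Hilbert–Schmidt. -/
theorem summable_norm_sq_adjoint (b : HilbertBasis ι ℂ E) (A : E →L[ℂ] E)
    (h : Summable fun i => ‖A (b i)‖ ^ 2) :
    Summable fun i => ‖ContinuousLinearMap.adjoint A (b i)‖ ^ 2 := by
  refine summable_of_sum_le (c := ∑' i, ‖A (b i)‖ ^ 2) (fun i => by positivity) fun S => ?_
  have h1 : HasSum (fun i => ∑ j ∈ S, ‖inner ℂ (b i) (ContinuousLinearMap.adjoint A (b j))‖ ^ 2)
      (∑ j ∈ S, ‖ContinuousLinearMap.adjoint A (b j)‖ ^ 2) :=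
    hasSum_sum fun j _ => b.hasSum_norm_inner_sq _
  refine hasSum_le (fun i => ?_) h1 h.hasSum
  refine le_trans (le_of_eq ?_) (b.orthonormal.sum_inner_products_le (A (b i)) (s := S))
  refine Finset.sum_congr rfl fun j _ => ?_
  rw [ContinuousLinearMap.adjoint_inner_right, norm_inner_symm]

/-- A product of two Hilbert–Schmidt operators is trace class. -/
theorem isTraceClass_comp [Countable ι] (b : HilbertBasis ι ℂ E) (A B : E →L[ℂ] E)
    (hA : Summable fun i => ‖A (b i)‖ ^ 2)
    (hB : Summable fun i => ‖ContinuousLinearMap.adjoint B (b i)‖ ^ 2) :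
    IsTraceClass (A ∘L B) := by
  obtain ⟨e, he⟩ := exists_injective_nat ι
  refine ⟨Function.extend e (fun i => ContinuousLinearMap.adjoint B (b i)) 0,
    Function.extend e (fun i => A (b i)) 0, ?_, fun f => ?_⟩
  · rw [← he.summable_iff]
    · refine Summable.of_nonneg_of_le (fun i => mul_nonneg (norm_nonneg _) (norm_nonneg _))
        (fun i => ?_) (hA.add hB)
      simp only [Function.comp_apply, he.extend_apply]
      nlinarith [sq_nonneg (‖ContinuousLinearMap.adjoint B (b i)‖ - ‖A (b i)‖),
        sq_nonneg ‖A (b i)‖, sq_nonneg ‖ContinuousLinearMap.adjoint B (b i)‖]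
    · intro n hn
      rw [Function.extend_apply' _ _ _ (by simpa using hn)]
      simp
  · rw [← he.hasSum_iff]
    · have h := (b.hasSum_repr (B f)).mapL A
      refine h.congr_fun fun i => ?_
      simp only [Function.comp_apply, he.extend_apply, map_smul, b.repr_apply_apply,
        ContinuousLinearMap.adjoint_inner_left]
    · intro n hn
      rw [Function.extend_apply' _ _ _ (by simpa using hn)]
      simp

end HilbertSchmidt

/-! ### The operators `Λ` and `Γ` over frequencies -/

section Operators

open scoped FourierTransform

instance secondCountableTopology_L2R : SecondCountableTopology L2R :=
  haveI : Fact ((2 : ℝ≥0∞) ≠ ∞) := ⟨by norm_num⟩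
  inferInstanceAs (SecondCountableTopology (Lp ℂ 2 (volume : Measure ℝ)))

variable {k : ℂ} (hk : 0 < k.im) (q : 𝓢(ℝ, ℂ))

/-- The modulations `x ↦ exp (2πixη) q(x)` of a Schwartz function. -/
abbrev modulateSchwartz (q : 𝓢(ℝ, ℂ)) (η : ℝ) : L2R := modulate q (q.memLp 2 volume) η

theorem norm_halfSymbol_sq (k : ℂ) (σ ξ : ℝ) : ‖halfSymbol k σ ξ‖ ^ 2 =
    ‖k / Complex.I + σ * (2 * Real.pi * Complex.I * ξ)‖⁻¹ := by
  have h1 : (-(1 / 2) : ℂ) = ((-(1 / 2) : ℝ) : ℂ) := by push_cast; rfl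
  rw [halfSymbol, h1, Complex.norm_cpow_real, ← Real.rpow_natCast, ← Real.rpow_mul (norm_nonneg _)]
  norm_num
  rw [Real.rpow_neg_one]

theorem halfSymbol_sq (k : ℂ) (σ ξ : ℝ) : halfSymbol k σ ξ ^ 2 =
    (k / Complex.I + σ * (2 * Real.pi * Complex.I * ξ))⁻¹ := by
  rw [halfSymbol, ← Complex.cpow_nat_mul]
  norm_num
  rw [Complex.cpow_neg_one]

theorem continuous_halfSymbol (hk : 0 < k.im) (σ : ℝ) : Continuous (halfSymbol k σ) := by
  unfold halfSymbol
  refine Continuous.cpow (by fun_prop) continuous_const fun ξ => Or.inl ?_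
  rw [halfSymbol_base_re]
  exact hk

theorem adjoint_halfResolvent (σ : ℝ) :
    ContinuousLinearMap.adjoint (halfResolvent k hk σ) =
      fourierMul (fun ξ => conj (halfSymbol k σ ξ)) (memLp_halfSymbol hk σ).star :=
  adjoint_fourierMul _ _ _

/-- `η ↦ |κ + 2πiη|⁻¹ ‖(κ - ∂)^{-1/2} (q e_η)‖²` with `κ = k / i` and `e_η(x) = exp (2πixη)`,
the density of the squared Hilbert–Schmidt norms of `Λ` and `Γ`, in terms of Fourier transforms. -/
def hilbertSchmidtDensity (k : ℂ) (q : 𝓢(ℝ, ℂ)) (η : ℝ) : ℝ :=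
  ‖halfSymbol k 1 η‖ ^ 2 * ∫ ξ, ‖halfSymbol k (-1) ξ‖ ^ 2 * ‖𝓕 (q : ℝ → ℂ) (ξ - η)‖ ^ 2

theorem integrable_hilbertSchmidtDensity (hk : 0 < k.im) :
    Integrable (hilbertSchmidtDensity k q) := by
  have hκ : 0 < (k / Complex.I).re := by simpa [Complex.div_I] using hk
  have h := integrable_symbol_prod
    (a := fun η => ‖halfSymbol k 1 η‖ ^ 2) (b := fun ξ => ‖halfSymbol k (-1) ξ‖ ^ 2)
    (Q := fun ξ => ‖𝓕 (q : ℝ → ℂ) ξ‖ ^ 2)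
    (by simp_rw [norm_halfSymbol_sq]; exact integrable_inv_norm_sq hκ one_ne_zero)
    (by simp_rw [norm_halfSymbol_sq]; exact integrable_inv_norm_sq hκ (by norm_num))
    ((continuous_halfSymbol hk 1).norm.pow 2) ((continuous_halfSymbol hk (-1)).norm.pow 2)
    (integrable_norm_sq_fourier q q.integrable (q.memLp 2 volume)) (fun x => by positivity)
    ((continuous_fourier_of_integrable q.integrable).norm.pow 2)
  refine h.integral_prod_right.congr (Eventually.of_forall fun η => ?_)
  simp only [hilbertSchmidtDensity]
  rw [← integral_const_mul]

theorem norm_sq_halfResolvent_modulate (η : ℝ) :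
    ‖halfSymbol k 1 η‖ ^ 2 * ‖halfResolvent k hk (-1) (modulateSchwartz q η)‖ ^ 2 =
      hilbertSchmidtDensity k q η := by
  rw [halfResolvent, norm_sq_fourierMul_modulate _ q.integrable, hilbertSchmidtDensity]

theorem norm_sq_adjoint_halfResolvent_modulate (η : ℝ) :
    ‖halfSymbol k 1 η‖ ^ 2 *
      ‖ContinuousLinearMap.adjoint (halfResolvent k hk (-1)) (modulateSchwartz q η)‖ ^ 2 =
      hilbertSchmidtDensity k q η := by
  rw [adjoint_halfResolvent, norm_sq_fourierMul_modulate _ q.integrable, hilbertSchmidtDensity]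
  simp

theorem coeFn_fourierL2_fourierMul_mulOp_conj (m : ℝ → ℂ)
    (hm : MemLp m ∞ (volume : Measure ℝ)) (R : L2R) :
    fourierL2 (fourierMul m hm (mulOp (fun x => conj (q x)) (memLp_conj_schwartz q) R))
      =ᵐ[volume] fun η => m η * inner ℂ (modulateSchwartz q η) R := by
  rw [fourierL2_fourierMul]
  filter_upwards [coeFn_mulOp m hm _, fourierL2_mulOp_conj q (q.memLp 2 volume)
    (memLp_conj_schwartz q) R] with η h1 h2
  rw [h1, h2]

/-- Hilbert–Schmidt criterion for `m(∂) q̄ B`: the Hilbert–Schmidt norm is computed by Parseval's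
identity for each modulation `q e_η`. -/
theorem summable_norm_sq_fourierMul_mulOp {ι : Type*} (b : HilbertBasis ι ℂ L2R) (m : ℝ → ℂ)
    (hm : MemLp m ∞ (volume : Measure ℝ)) (B : L2R →L[ℂ] L2R) {c : ℝ → ℝ} (hc : Integrable c)
    (hB : ∀ η, ‖m η‖ ^ 2 * ‖ContinuousLinearMap.adjoint B (modulateSchwartz q η)‖ ^ 2 ≤ c η) :
    Summable fun i =>
      ‖fourierMul m hm (mulOp (fun x => conj (q x)) (memLp_conj_schwartz q) (B (b i)))‖ ^ 2 := by
  have hae : ∀ i, (fun η => ‖fourierL2 (fourierMul m hm (mulOp (fun x => conj (q x))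
      (memLp_conj_schwartz q) (B (b i)))) η‖ ^ 2) =ᵐ[volume]
      fun η => ‖m η‖ ^ 2 * ‖inner ℂ (modulateSchwartz q η) (B (b i))‖ ^ 2 := by
    intro i
    filter_upwards [coeFn_fourierL2_fourierMul_mulOp_conj q m hm (B (b i))] with η h
    rw [h, norm_mul, mul_pow]
  have hint : ∀ i, Integrable fun η =>
      ‖m η‖ ^ 2 * ‖inner ℂ (modulateSchwartz q η) (B (b i))‖ ^ 2 := fun i =>
    (integrable_norm_sq_L2R _).congr (hae i)
  have hval : ∀ i, ‖fourierMul m hm (mulOp (fun x => conj (q x)) (memLp_conj_schwartz q)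
      (B (b i)))‖ ^ 2 = ∫ η, ‖m η‖ ^ 2 * ‖inner ℂ (modulateSchwartz q η) (B (b i))‖ ^ 2 := by
    intro i
    rw [← fourierL2.norm_map, norm_sq_L2R]
    exact integral_congr_ae (hae i)
  refine summable_of_sum_le (c := ∫ η, c η) (fun i => by positivity) fun S => ?_
  simp_rw [hval]
  rw [← integral_finsetSum _ fun i _ => hint i]
  refine integral_mono (integrable_finsetSum _ fun i _ => hint i) hc fun η => ?_
  simp only
  rw [← Finset.mul_sum]
  refine le_trans (mul_le_mul_of_nonneg_left ?_ (by positivity)) (hB η)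
  refine le_trans (le_of_eq ?_) (b.orthonormal.sum_inner_products_le _ (s := S))
  refine Finset.sum_congr rfl fun i _ => ?_
  rw [ContinuousLinearMap.adjoint_inner_right, norm_inner_symm]

theorem adjoint_LambdaOp_apply (f : L2R) :
    ContinuousLinearMap.adjoint (LambdaOp k hk q) f =
      fourierMul (fun ξ => conj (halfSymbol k 1 ξ)) (memLp_halfSymbol hk 1).star
        (mulOp (fun x => conj (q x)) (memLp_conj_schwartz q)
          (ContinuousLinearMap.adjoint (halfResolvent k hk (-1)) f)) := by
  rw [LambdaOp, ContinuousLinearMap.adjoint_comp, ContinuousLinearMap.adjoint_comp,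
    adjoint_halfResolvent hk 1, adjoint_mulOp _ _ (memLp_conj_schwartz q)]
  rfl

theorem isTraceClass_smul_LambdaOp_comp_GammaOp (c : ℂ) :
    IsTraceClass (c • (LambdaOp k hk q ∘L GammaOp k hk q)) := by
  obtain ⟨w, b, -⟩ := exists_hilbertBasis ℂ L2R
  have := b.countable_index
  have hG : Summable fun i => ‖GammaOp k hk q (b i)‖ ^ 2 :=
    summable_norm_sq_fourierMul_mulOp q b (halfSymbol k 1) (memLp_halfSymbol hk 1)
      (halfResolvent k hk (-1)) (integrable_hilbertSchmidtDensity q hk)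
      fun η => (norm_sq_adjoint_halfResolvent_modulate hk q η).le
  have hL : Summable fun i => ‖ContinuousLinearMap.adjoint (LambdaOp k hk q) (b i)‖ ^ 2 := by
    simp_rw [adjoint_LambdaOp_apply]
    refine summable_norm_sq_fourierMul_mulOp q b _ (memLp_halfSymbol hk 1).star
      (ContinuousLinearMap.adjoint (halfResolvent k hk (-1)))
      (integrable_hilbertSchmidtDensity q hk) fun η => ?_
    rw [ContinuousLinearMap.adjoint_adjoint, ← norm_sq_halfResolvent_modulate hk q η]
    simp
  have hL' := summable_norm_sq_adjoint b _ hL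
  rw [ContinuousLinearMap.adjoint_adjoint] at hL'
  rw [← ContinuousLinearMap.smul_comp]
  refine isTraceClass_comp b _ _ ?_ (summable_norm_sq_adjoint b _ hG)
  refine (hL'.mul_left (‖c‖ ^ 2)).congr fun i => ?_
  rw [smul_apply, norm_smul, mul_pow]

/-- The representation of `ΛΓ` as an integral of rank one operators over frequencies. -/
theorem inner_LambdaOp_GammaOp (f g : L2R) :
    inner ℂ f (LambdaOp k hk q (GammaOp k hk q g)) =
      ∫ η, inner ℂ f (halfResolvent k hk (-1) (modulateSchwartz q η)) * halfSymbol k 1 η ^ 2 *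
        inner ℂ (ContinuousLinearMap.adjoint (halfResolvent k hk (-1))
          (modulateSchwartz q η)) g := by
  rw [← ContinuousLinearMap.adjoint_inner_left, adjoint_LambdaOp_apply,
    ← fourierL2.inner_map_map, inner_L2R]
  refine integral_congr_ae ?_
  filter_upwards [coeFn_fourierL2_fourierMul_mulOp_conj q
    (fun ξ => conj (halfSymbol k 1 ξ)) (memLp_halfSymbol hk 1).star
      (ContinuousLinearMap.adjoint (halfResolvent k hk (-1)) f),
    coeFn_fourierL2_fourierMul_mulOp_conj q (halfSymbol k 1) (memLp_halfSymbol hk 1)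
      (halfResolvent k hk (-1) g)] with η h1 h2
  have h3 : fourierL2 (GammaOp k hk q g) η =
      halfSymbol k 1 η * inner ℂ (modulateSchwartz q η) (halfResolvent k hk (-1) g) := h2
  rw [h1, h3, map_mul, Complex.conj_conj, inner_conj_symm, ContinuousLinearMap.adjoint_inner_left,
    ContinuousLinearMap.adjoint_inner_left]
  ring

/-- The Fredholm expansion of `det (1 + c ΛΓ)` over frequencies. -/
theorem hasFredholmDet_smul_LambdaOp_comp_GammaOp (c : ℂ) :
    HasFredholmDet (c • (LambdaOp k hk q ∘L GammaOp k hk q))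
      (∑' n : ℕ, (n.factorial : ℂ)⁻¹ * ∫ η : Fin n → ℝ, Matrix.det (Matrix.of fun i j =>
        inner ℂ (ContinuousLinearMap.adjoint (halfResolvent k hk (-1)) (modulateSchwartz q (η i)))
          ((c * halfSymbol k 1 (η j) ^ 2) •
            halfResolvent k hk (-1) (modulateSchwartz q (η j))))
        ∂(Measure.pi fun _ => (volume : Measure ℝ))) := by
  refine ⟨isTraceClass_smul_LambdaOp_comp_GammaOp hk q c, fun ι b => ?_⟩
  have := b.countable_index
  refine hasSum_principalMinor_of_integral b _ (μ := (volume : Measure ℝ))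
    (x := fun η => ContinuousLinearMap.adjoint (halfResolvent k hk (-1)) (modulateSchwartz q η))
    (y := fun η => (c * halfSymbol k 1 η ^ 2) • halfResolvent k hk (-1) (modulateSchwartz q η))
    ((integrable_hilbertSchmidtDensity q hk).const_mul ‖c‖) (fun η => ?_) (fun i => ?_)
    (fun i => ?_) fun i j => ?_
  · have h1 := norm_sq_halfResolvent_modulate hk q η
    have h2 := norm_sq_adjoint_halfResolvent_modulate hk q η
    rw [norm_smul, norm_mul, norm_pow]
    have h3 : ‖c‖ * hilbertSchmidtDensity k q η = ‖c‖ * (1 / 2 *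
        (hilbertSchmidtDensity k q η + hilbertSchmidtDensity k q η)) := by ring
    rw [h3]
    nth_rw 1 [← h1]
    rw [← h2]
    set u := ‖ContinuousLinearMap.adjoint (halfResolvent k hk (-1)) (modulateSchwartz q η)‖
    set v := ‖halfResolvent k hk (-1) (modulateSchwartz q η)‖
    have h4 : 0 ≤ ‖c‖ * ‖halfSymbol k 1 η‖ ^ 2 * (u - v) ^ 2 := by positivity
    nlinarith
  · simp_rw [ContinuousLinearMap.adjoint_inner_left]
    exact (continuous_inner_modulate _ _ _).measurable
  · simp_rw [inner_smul_right, ← ContinuousLinearMap.adjoint_inner_left (halfResolvent k hk (-1))]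
    have h1 : Continuous fun η => inner ℂ
        (ContinuousLinearMap.adjoint (halfResolvent k hk (-1)) (b i)) (modulateSchwartz q η) := by
      refine (Complex.continuous_conj.comp (continuous_inner_modulate q (q.memLp 2 volume)
        (ContinuousLinearMap.adjoint (halfResolvent k hk (-1)) (b i)))).congr fun η => ?_
      exact inner_conj_symm _ _
    exact ((continuous_const.mul ((continuous_halfSymbol hk 1).pow 2)).mul h1).measurable
  · rw [smul_apply, inner_smul_right, ContinuousLinearMap.comp_apply,
      inner_LambdaOp_GammaOp, ← integral_const_mul]
    refine integral_congr_ae (Eventually.of_forall fun η => ?_)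
    simp only [inner_smul_right]
    ring

end Operators

/-! ### The resolvent `(κ - ∂)⁻¹` -/

section BackwardResolvent

open scoped FourierTransform Convolution

/-- The integral operator `φ ↦ ∫_x^∞ exp (κ(x - y)) φ(y) dy`, the inverse of `κ - ∂`. -/
def backwardResolvent (κ : ℂ) (φ : ℝ → ℂ) (x : ℝ) : ℂ :=
  ∫ y in Set.Ioi x, Complex.exp (κ * (x - y)) * φ y

/-- The convolution kernel `exp (κ t)`, `t < 0`, of `(κ - ∂)⁻¹`. -/
def backwardKernel (κ : ℂ) (t : ℝ) : ℂ :=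
  (Set.Iio 0).indicator (fun t : ℝ => Complex.exp (κ * t)) t

variable {κ : ℂ} {φ : ℝ → ℂ}

theorem integrable_backwardKernel (hκ : 0 < κ.re) : Integrable (backwardKernel κ) := by
  unfold backwardKernel
  rw [integrable_indicator_iff measurableSet_Iio]
  exact (integrableOn_exp_mul_complex_Iic hκ 0).mono_set Set.Iio_subset_Iic_self

theorem norm_backwardKernel_le (hκ : 0 < κ.re) (t : ℝ) : ‖backwardKernel κ t‖ ≤ 1 := by
  unfold backwardKernel
  by_cases ht : t ∈ Set.Iio (0 : ℝ)
  · rw [Set.indicator_of_mem ht, Complex.norm_exp, Real.exp_le_one_iff]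
    have : t < 0 := ht
    simp
    nlinarith
  · rw [Set.indicator_of_notMem ht, norm_zero]
    exact zero_le_one

theorem fourier_backwardKernel (hκ : 0 < κ.re) (ξ : ℝ) :
    𝓕 (backwardKernel κ) ξ = (κ - 2 * Real.pi * Complex.I * ξ)⁻¹ := by
  have h1 : ∀ x : ℝ, Complex.exp (-(2 * Real.pi * x * ξ * Complex.I)) * backwardKernel κ x =
      (Set.Iio 0).indicator
        (fun t : ℝ => Complex.exp ((κ - 2 * Real.pi * Complex.I * ξ) * t)) x := by
    intro x
    unfold backwardKernel
    by_cases hx : x ∈ Set.Iio (0 : ℝ)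
    · rw [Set.indicator_of_mem hx, Set.indicator_of_mem hx, ← Complex.exp_add]
      congr 1
      ring
    · rw [Set.indicator_of_notMem hx, Set.indicator_of_notMem hx, mul_zero]
  rw [fourier_real_eq]
  simp_rw [h1]
  rw [integral_indicator measurableSet_Iio, ← integral_Iic_eq_integral_Iio,
    integral_exp_mul_complex_Iic (by simpa using hκ)]
  simp

theorem backwardResolvent_integrand (κ : ℂ) (φ : ℝ → ℂ) (x y : ℝ) :
    (Set.Ioi x).indicator (fun y : ℝ => Complex.exp (κ * (x - y)) * φ y) y =
      φ y * backwardKernel κ (x - y) := by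
  unfold backwardKernel
  by_cases hy : y ∈ Set.Ioi x
  · have hy' : x - y ∈ Set.Iio (0 : ℝ) := sub_neg.2 (Set.mem_Ioi.1 hy)
    rw [Set.indicator_of_mem hy, Set.indicator_of_mem hy', mul_comm]
    push_cast
    rfl
  · have hy' : x - y ∉ Set.Iio (0 : ℝ) := fun h =>
      hy (Set.mem_Ioi.2 (sub_neg.1 (Set.mem_Iio.1 h)))
    rw [Set.indicator_of_notMem hy, Set.indicator_of_notMem hy', mul_zero]

theorem backwardResolvent_eq_convolution (κ : ℂ) (φ : ℝ → ℂ) :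
    backwardResolvent κ φ = φ ⋆[ContinuousLinearMap.mul ℂ ℂ] backwardKernel κ := by
  ext x
  rw [backwardResolvent, convolution_def, ← integral_indicator measurableSet_Ioi]
  exact integral_congr_ae (Eventually.of_forall fun y => backwardResolvent_integrand κ φ x y)

theorem integrable_backwardResolvent (hκ : 0 < κ.re) (hφ : Integrable φ) :
    Integrable (backwardResolvent κ φ) := by
  rw [backwardResolvent_eq_convolution]
  exact hφ.integrable_convolution _ (integrable_backwardKernel hκ)

theorem fourier_backwardResolvent (hκ : 0 < κ.re) (hφ : Integrable φ) (ξ : ℝ) :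
    𝓕 (backwardResolvent κ φ) ξ = (κ - 2 * Real.pi * Complex.I * ξ)⁻¹ * 𝓕 φ ξ := by
  rw [backwardResolvent_eq_convolution,
    Real.fourier_mul_convolution_eq hφ (integrable_backwardKernel hκ), fourier_backwardKernel hκ,
    mul_comm]

theorem norm_backwardResolvent_le (hκ : 0 < κ.re) (hφ : Integrable φ) (x : ℝ) :
    ‖backwardResolvent κ φ x‖ ≤ ∫ y, ‖φ y‖ := by
  rw [backwardResolvent_eq_convolution, convolution_def]
  refine norm_integral_le_of_norm_le hφ.norm (Eventually.of_forall fun y => ?_)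
  rw [ContinuousLinearMap.mul_apply', norm_mul]
  exact mul_le_of_le_one_right (norm_nonneg _) (norm_backwardKernel_le hκ _)

theorem memLp_two_backwardResolvent (hκ : 0 < κ.re) (hφ : Integrable φ) :
    MemLp (backwardResolvent κ φ) 2 volume := by
  have hi := integrable_backwardResolvent hκ hφ
  rw [memLp_two_iff_integrable_sq_norm hi.1]
  refine (hi.norm.const_mul (∫ y, ‖φ y‖)).mono' (hi.1.norm.pow 2) (Eventually.of_forall fun x => ?_)
  rw [Real.norm_of_nonneg (by positivity), sq]
  exact mul_le_mul_of_nonneg_right (norm_backwardResolvent_le hκ hφ x) (norm_nonneg _)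

theorem continuous_backwardResolvent (hκ : 0 < κ.re) (hφ : Integrable φ) :
    Continuous (backwardResolvent κ φ) := by
  have hint : ∀ s : ℝ, IntegrableOn (fun y : ℝ => Complex.exp (-(κ * y)) * φ y) (Set.Ioi s) := by
    intro s
    refine Integrable.mono' (g := fun y => Real.exp (-(κ.re * s)) * ‖φ y‖)
      (hφ.norm.const_mul _).integrableOn
      ((Continuous.aestronglyMeasurable (by fun_prop)).mul hφ.1.restrict) ?_
    refine ae_restrict_of_forall_mem measurableSet_Ioi fun y hy => ?_
    have : s < y := hy
    rw [norm_mul, Complex.norm_exp]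
    simp only [Complex.neg_re, Complex.mul_re, Complex.ofReal_re, Complex.ofReal_im, mul_zero,
      sub_zero]
    gcongr
  have hprim : ∀ a b, IntervalIntegrable
      (fun y : ℝ => Complex.exp (-(κ * y)) * φ y) volume a b := by
    intro a b
    rw [intervalIntegrable_iff]
    exact (hint (min a b)).mono_set fun y hy => hy.1
  have heq : backwardResolvent κ φ = fun x : ℝ => Complex.exp (κ * x) *
      ((∫ y in Set.Ioi (0 : ℝ), Complex.exp (-(κ * y)) * φ y) -
        ∫ y in (0 : ℝ)..x, Complex.exp (-(κ * y)) * φ y) := by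
    ext x
    rw [← intervalIntegral.integral_Ioi_sub_Ioi' (hint 0) (hint x), sub_sub_cancel,
      backwardResolvent, ← integral_const_mul]
    refine integral_congr_ae (Eventually.of_forall fun y => ?_)
    simp only
    rw [← mul_assoc, ← Complex.exp_add]
    congr 2
    ring
  rw [heq]
  exact (Continuous.cexp (by fun_prop)).mul
    (continuous_const.sub (intervalIntegral.continuous_primitive hprim 0))

/-- Fourier inversion for `(κ - ∂)⁻¹ φ`. -/
theorem integral_inv_mul_fourier (hκ : 0 < κ.re) (hφ : Integrable φ)
    (hi : Integrable fun ξ : ℝ => (κ - 2 * Real.pi * Complex.I * ξ)⁻¹ * 𝓕 φ ξ) (x : ℝ) :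
    ∫ ξ : ℝ, Complex.exp (2 * Real.pi * ξ * x * Complex.I) *
      ((κ - 2 * Real.pi * Complex.I * ξ)⁻¹ * 𝓕 φ ξ) = backwardResolvent κ φ x := by
  have hF : 𝓕 (backwardResolvent κ φ) =
      fun ξ : ℝ => (κ - 2 * Real.pi * Complex.I * ξ)⁻¹ * 𝓕 φ ξ :=
    funext (fourier_backwardResolvent hκ hφ)
  have h := congrFun ((continuous_backwardResolvent hκ hφ).fourierInv_fourier_eq
    (integrable_backwardResolvent hκ hφ) (by rw [hF]; exact hi)) x
  rw [← h, Real.fourierInv_eq', hF]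
  refine integral_congr_ae (Eventually.of_forall fun ξ => ?_)
  simp only [smul_eq_mul]
  congr 2
  simp
  ring

end BackwardResolvent

/-! ### From frequencies to positions -/

section Kernel

open scoped FourierTransform

variable {k : ℂ} (hk : 0 < k.im) (q : 𝓢(ℝ, ℂ))

theorem div_I_re_pos (hk : 0 < k.im) : 0 < (k / Complex.I).re := by
  simpa [Complex.div_I] using hk

/-- `(κ - ∂)^{-1/2}` squares to `(κ - ∂)⁻¹`. -/
theorem halfResolvent_halfResolvent {φ : ℝ → ℂ} (h1 : Integrable φ) (h2 : MemLp φ 2 volume) :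
    halfResolvent k hk (-1) (halfResolvent k hk (-1) (h2.toLp φ)) =
      (memLp_two_backwardResolvent (div_I_re_pos hk) h1).toLp
        (backwardResolvent (k / Complex.I) φ) := by
  refine fourierL2.injective (Lp.ext ?_)
  have h3 : fourierL2 (halfResolvent k hk (-1) (halfResolvent k hk (-1) (h2.toLp φ))) =
      mulOp (halfSymbol k (-1)) (memLp_halfSymbol hk (-1))
        (mulOp (halfSymbol k (-1)) (memLp_halfSymbol hk (-1)) (fourierL2 (h2.toLp φ))) := by
    rw [halfResolvent, fourierL2_fourierMul, fourierL2_fourierMul]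
  rw [h3]
  filter_upwards [coeFn_mulOp (halfSymbol k (-1)) (memLp_halfSymbol hk (-1))
      (mulOp (halfSymbol k (-1)) (memLp_halfSymbol hk (-1)) (fourierL2 (h2.toLp φ))),
    coeFn_mulOp (halfSymbol k (-1)) (memLp_halfSymbol hk (-1)) (fourierL2 (h2.toLp φ)),
    coeFn_fourierL2_toLp h1 h2,
    coeFn_fourierL2_toLp (integrable_backwardResolvent (div_I_re_pos hk) h1)
      (memLp_two_backwardResolvent (div_I_re_pos hk) h1)] with ξ e1 e2 e3 e4
  rw [e1, e2, e3, e4, fourier_backwardResolvent (div_I_re_pos hk) h1, ← mul_assoc, ← sq,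
    halfSymbol_sq]
  congr 2
  push_cast
  ring

/-- The function `x ↦ (κ - ∂)⁻¹ (q e_η)(x)`, where `e_η(y) = exp (2πiyη)`. -/
def resolventModulate (κ : ℂ) (q : 𝓢(ℝ, ℂ)) (η x : ℝ) : ℂ :=
  backwardResolvent κ (fun y : ℝ => Complex.exp (2 * Real.pi * y * η * Complex.I) * q y) x

theorem integrable_modulation (η : ℝ) :
    Integrable fun y : ℝ => Complex.exp (2 * Real.pi * y * η * Complex.I) * q y := by
  refine q.integrable.mono ((Continuous.aestronglyMeasurable (by fun_prop)).mul q.integrable.1)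
    (Eventually.of_forall fun x => ?_)
  rw [norm_mul, norm_cexp_modulation, one_mul]

theorem inner_halfResolvent_modulate (η η' : ℝ) :
    inner ℂ (ContinuousLinearMap.adjoint (halfResolvent k hk (-1)) (modulateSchwartz q η))
      (halfResolvent k hk (-1) (modulateSchwartz q η')) =
      ∫ x : ℝ, Complex.exp (-(2 * Real.pi * x * η * Complex.I)) *
        (conj (q x) * resolventModulate (k / Complex.I) q η' x) := by
  rw [ContinuousLinearMap.adjoint_inner_left, modulateSchwartz, modulate,
    modulateSchwartz, modulate, halfResolvent_halfResolvent hk (integrable_modulation q η'),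
    inner_L2R]
  refine integral_congr_ae ?_
  filter_upwards [coeFn_modulate q (q.memLp 2 volume) η, (memLp_two_backwardResolvent
    (div_I_re_pos hk) (integrable_modulation q η')).coeFn_toLp] with x h1 h2
  rw [modulate] at h1
  rw [h1, h2, map_mul, conj_cexp_modulation, resolventModulate, mul_assoc]

/-- The constant `sup |q| + ∫ |q'|` that bounds the two terms arising from an integration by parts
against a kernel of modulus at most one. -/
def byPartsConst (q : 𝓢(ℝ, ℂ)) : ℝ := SchwartzMap.seminorm ℝ 0 0 q + ∫ x, ‖deriv q x‖

/-- Integration by parts: `(κ - ∂)⁻¹ (q e_η)` is `O(|κ - 2πiη|⁻¹)`. -/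
theorem norm_resolventModulate_le {κ : ℂ} (hκ : 0 < κ.re) (η x : ℝ) :
    ‖resolventModulate κ q η x‖ ≤
      byPartsConst q * ‖κ - 2 * Real.pi * Complex.I * η‖⁻¹ := by
  set β : ℂ := κ - 2 * Real.pi * Complex.I * η with hβ
  have hβre : β.re = κ.re := by simp [hβ]
  have hβ0 : β ≠ 0 := fun h => by
    rw [h] at hβre
    simp at hβre
    exact hκ.ne hβre
  have hdq : Integrable (deriv q) := (SchwartzMap.derivCLM ℂ ℂ q).integrable
  set e : ℝ → ℂ := fun y => Complex.exp (κ * x - β * y) with he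
  have hen : ∀ y : ℝ, x ≤ y → ‖e y‖ ≤ 1 := by
    intro y hy
    rw [he]
    simp only
    rw [Complex.norm_exp, Real.exp_le_one_iff]
    simp only [Complex.sub_re, Complex.mul_re, Complex.ofReal_re, Complex.ofReal_im, mul_zero,
      sub_zero, hβre]
    nlinarith
  have hec : Continuous e := by
    rw [he]
    fun_prop
  have he' : ∀ y : ℝ, HasDerivAt e (-β * e y) y := by
    intro y
    have h := (((Complex.ofRealCLM.hasDerivAt (x := y)).const_mul β).const_sub (κ * x)).cexp
    refine h.congr_deriv ?_
    simp only [he, Complex.ofRealCLM_apply, Complex.ofReal_one]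
    ring
  have hi1 : IntegrableOn (fun y => e y * q y) (Set.Ioi x) := by
    refine q.integrable.norm.integrableOn.mono' (hec.mul q.continuous).aestronglyMeasurable ?_
    refine ae_restrict_of_forall_mem measurableSet_Ioi fun y hy => ?_
    rw [norm_mul]
    exact mul_le_of_le_one_left (norm_nonneg _) (hen y (le_of_lt hy))
  have hi2 : IntegrableOn (fun y => e y * deriv q y) (Set.Ioi x) := by
    refine hdq.norm.integrableOn.mono' (hec.aestronglyMeasurable.mul hdq.1.restrict) ?_
    refine ae_restrict_of_forall_mem measurableSet_Ioi fun y hy => ?_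
    rw [norm_mul]
    exact mul_le_of_le_one_left (norm_nonneg _) (hen y (le_of_lt hy))
  have hlim : Tendsto (fun y => e y * q y) atTop (𝓝 0) := by
    have hq0 : Tendsto q atTop (𝓝 0) := q.toZeroAtInfty.zero_at_infty'.mono_left atTop_le_cocompact
    refine squeeze_zero_norm' ?_ (tendsto_zero_iff_norm_tendsto_zero.1 hq0)
    filter_upwards [eventually_ge_atTop x] with y hy
    rw [norm_mul]
    exact mul_le_of_le_one_left (norm_nonneg _) (hen y hy)
  have hparts := integral_Ioi_of_hasDerivAt_of_tendsto (a := x) (m := 0)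
    (f := fun y => e y * q y) (f' := fun y => -β * (e y * q y) + e y * deriv q y)
    (hec.mul q.continuous).continuousWithinAt
    (fun y _ => ((he' y).mul (q.hasDerivAt y)).congr_deriv (by ring))
    ((hi1.const_mul _).add hi2) hlim
  rw [integral_add (hi1.const_mul _) hi2, integral_const_mul] at hparts
  have hres : resolventModulate κ q η x = ∫ y in Set.Ioi x, e y * q y := by
    unfold resolventModulate backwardResolvent
    refine integral_congr_ae (Eventually.of_forall fun y => ?_)
    simp only [he, hβ]
    rw [← mul_assoc, ← Complex.exp_add]
    congr 2
    ring
  have hmain : β * resolventModulate κ q η x = e x * q x + ∫ y in Set.Ioi x, e y * deriv q y := by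
    rw [hres]
    linear_combination -hparts
  have hbd : ‖β * resolventModulate κ q η x‖ ≤ byPartsConst q := by
    rw [hmain]
    refine (norm_add_le _ _).trans (add_le_add ?_ ?_)
    · rw [norm_mul]
      exact (mul_le_of_le_one_left (norm_nonneg _) (hen x le_rfl)).trans
        (q.norm_le_seminorm ℝ x)
    · refine (norm_integral_le_of_norm_le hdq.norm.integrableOn
        (ae_restrict_of_forall_mem measurableSet_Ioi fun y hy => ?_)).trans
        (setIntegral_le_integral hdq.norm (Eventually.of_forall fun _ => norm_nonneg _))
      rw [norm_mul]
      exact mul_le_of_le_one_left (norm_nonneg _) (hen y (le_of_lt hy))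
  rw [norm_mul] at hbd
  rw [← div_eq_mul_inv, le_div_iff₀ (norm_pos_iff.2 hβ0), mul_comm]
  exact hbd

theorem measurable_resolventModulate (κ : ℂ) :
    Measurable fun z : ℝ × ℝ => resolventModulate κ q z.2 z.1 := by
  have hK : Measurable (backwardKernel κ) := by
    unfold backwardKernel
    exact Measurable.indicator (by fun_prop) measurableSet_Iio
  have h : StronglyMeasurable fun z : (ℝ × ℝ) × ℝ =>
      Complex.exp (2 * Real.pi * z.2 * z.1.2 * Complex.I) * q z.2 *
        backwardKernel κ (z.1.1 - z.2) := by
    refine Measurable.stronglyMeasurable ?_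
    have := q.continuous.measurable
    fun_prop
  have h2 : (fun z : ℝ × ℝ => resolventModulate κ q z.2 z.1) = fun z : ℝ × ℝ => ∫ y : ℝ,
      Complex.exp (2 * Real.pi * y * z.2 * Complex.I) * q y * backwardKernel κ (z.1 - y) := by
    ext z
    rw [resolventModulate, backwardResolvent_eq_convolution, convolution_def]
    rfl
  rw [h2]
  exact (h.integral_prod_right' (ν := volume)).measurable

theorem integrable_inv_norm_mul_inv_norm {κ : ℂ} (hκ : 0 < κ.re) :
    Integrable fun η : ℝ => ‖κ + 2 * Real.pi * Complex.I * η‖⁻¹ *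
      ‖κ - 2 * Real.pi * Complex.I * η‖⁻¹ := by
  have h1 := integrable_inv_norm_sq hκ one_ne_zero
  have h2 := integrable_inv_norm_sq hκ (σ := -1) (by norm_num)
  have e1 : ∀ η : ℝ, κ + ((1 : ℝ) : ℂ) * (2 * Real.pi * Complex.I * η) =
      κ + 2 * Real.pi * Complex.I * η := fun η => by push_cast; ring
  have e2 : ∀ η : ℝ, κ + ((-1 : ℝ) : ℂ) * (2 * Real.pi * Complex.I * η) =
      κ - 2 * Real.pi * Complex.I * η := fun η => by push_cast; ring
  simp_rw [e1] at h1
  simp_rw [e2] at h2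
  refine (h1.add h2).mono' (Measurable.aestronglyMeasurable (by fun_prop))
    (Eventually.of_forall fun η => ?_)
  set u := ‖κ + 2 * Real.pi * Complex.I * η‖⁻¹
  set v := ‖κ - 2 * Real.pi * Complex.I * η‖⁻¹
  rw [Real.norm_eq_abs, abs_le]
  simp only [Pi.add_apply]
  constructor <;> nlinarith [sq_nonneg (u + v), sq_nonneg (u - v)]

/-- The frequency integral that produces the kernel of `q̄ (κ - ∂)⁻¹ q (κ + ∂)⁻¹` in position
space. -/
theorem integral_resolventModulate {κ : ℂ} (hκ : 0 < κ.re) (x x' : ℝ) :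
    ∫ η : ℝ, (κ + 2 * Real.pi * Complex.I * η)⁻¹ * resolventModulate κ q η x *
        Complex.exp (-(2 * Real.pi * x' * η * Complex.I)) =
      Complex.exp (κ * x) * Complex.exp (κ * x') * jostTail q κ (max x x') := by
  set φ : ℝ → ℂ := fun y => (Set.Ioi x).indicator (fun y : ℝ => Complex.exp (κ * (x - y)) * q y) y
    with hφ
  have hφi : Integrable φ := by
    refine q.integrable.norm.mono' ?_ (Eventually.of_forall fun y => ?_)
    · refine AEStronglyMeasurable.indicator ?_ measurableSet_Ioi
      have := q.continuous
      exact Continuous.aestronglyMeasurable (by fun_prop)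
    · simp only [hφ, backwardResolvent_integrand, norm_mul]
      exact mul_le_of_le_one_right (norm_nonneg _) (norm_backwardKernel_le hκ _)
  have hF : ∀ η : ℝ, resolventModulate κ q η x = 𝓕 φ (-η) := by
    intro η
    rw [fourier_real_eq, resolventModulate, backwardResolvent,
      ← integral_indicator measurableSet_Ioi]
    refine integral_congr_ae (Eventually.of_forall fun y => ?_)
    simp only [hφ]
    by_cases hy : y ∈ Set.Ioi x
    · rw [Set.indicator_of_mem hy, Set.indicator_of_mem hy]
      push_cast
      rw [mul_neg, neg_mul, neg_neg]
      ring
    · rw [Set.indicator_of_notMem hy, Set.indicator_of_notMem hy, mul_zero]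
  have hi : Integrable fun ξ : ℝ => (κ - 2 * Real.pi * Complex.I * ξ)⁻¹ * 𝓕 φ ξ := by
    refine (((integrable_inv_norm_mul_inv_norm hκ).const_mul (byPartsConst q))).mono'
      ((Measurable.aestronglyMeasurable (by fun_prop)).mul
        (continuous_fourier_of_integrable hφi).aestronglyMeasurable)
      (Eventually.of_forall fun ξ => ?_)
    have h1 := norm_resolventModulate_le q hκ (-ξ) x
    rw [hF, neg_neg] at h1
    push_cast at h1
    rw [mul_neg, sub_neg_eq_add] at h1
    rw [norm_mul, norm_inv]
    refine (mul_le_mul_of_nonneg_left h1 (by positivity)).trans (le_of_eq (by ring))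
  have hinv := integral_inv_mul_fourier hκ hφi hi x'
  -- Replacing `η` by `-η` turns the Fourier transform of `φ` at `-η` into an inversion integral.
  have hflip := integral_neg_eq_self (fun ξ : ℝ =>
    Complex.exp (2 * Real.pi * ξ * x' * Complex.I) *
      ((κ - 2 * Real.pi * Complex.I * ξ)⁻¹ * 𝓕 φ ξ)) volume
  rw [hinv] at hflip
  have hL : ∫ η : ℝ, (κ + 2 * Real.pi * Complex.I * η)⁻¹ * resolventModulate κ q η x *
        Complex.exp (-(2 * Real.pi * x' * η * Complex.I)) = backwardResolvent κ φ x' := by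
    rw [← hflip]
    refine integral_congr_ae (Eventually.of_forall fun η => ?_)
    simp only
    rw [hF]
    push_cast
    rw [show (2 * Real.pi * -(η : ℂ) * x' * Complex.I : ℂ) =
      -(2 * Real.pi * x' * η * Complex.I) by ring,
      show κ - 2 * Real.pi * Complex.I * -(η : ℂ) = κ + 2 * Real.pi * Complex.I * η by ring]
    ring
  rw [hL, backwardResolvent, jostTail, ← integral_indicator measurableSet_Ioi,
    ← integral_indicator measurableSet_Ioi, ← integral_const_mul]
  refine integral_congr_ae (Eventually.of_forall fun y => ?_)
  simp only
  by_cases hy : y ∈ Set.Ioi (max x x')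
  · have hy1 : y ∈ Set.Ioi x :=
      Set.mem_Ioi.2 (lt_of_le_of_lt (le_max_left _ _) (Set.mem_Ioi.1 hy))
    have hy2 : y ∈ Set.Ioi x' :=
      Set.mem_Ioi.2 (lt_of_le_of_lt (le_max_right _ _) (Set.mem_Ioi.1 hy))
    rw [Set.indicator_of_mem hy, Set.indicator_of_mem hy2, hφ]
    simp only
    rw [Set.indicator_of_mem hy1, ← Complex.exp_add, mul_comm (q y), ← mul_assoc, ← mul_assoc,
      ← Complex.exp_add, ← Complex.exp_add]
    congr 2
    ring
  · rw [Set.indicator_of_notMem hy, mul_zero]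
    by_cases hy2 : y ∈ Set.Ioi x'
    · have hy1 : y ∉ Set.Ioi x := fun h =>
        hy (Set.mem_Ioi.2 (max_lt (Set.mem_Ioi.1 h) (Set.mem_Ioi.1 hy2)))
      rw [Set.indicator_of_mem hy2, hφ]
      simp only
      rw [Set.indicator_of_notMem hy1, mul_zero]
    · rw [Set.indicator_of_notMem hy2]

/-- Passing from frequencies to positions in the Fredholm expansion. The kernel over frequencies
factors as `∫ a η x * b x η' dx`; by cyclicity it may be replaced by `∫ b x η * a η x' dη`, which is
the kernel of `c q̄ (κ - ∂)⁻¹ q (κ + ∂)⁻¹`. Conjugation by `exp (κ x)` turns the latter into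
`c w(x) H(max x x')` without changing determinants. -/
theorem integral_det_frequency_eq (c : ℂ) (n : ℕ) :
    ∫ η : Fin n → ℝ, Matrix.det (Matrix.of fun i j =>
        inner ℂ (ContinuousLinearMap.adjoint (halfResolvent k hk (-1)) (modulateSchwartz q (η i)))
          ((c * halfSymbol k 1 (η j) ^ 2) •
            halfResolvent k hk (-1) (modulateSchwartz q (η j))))
        ∂(Measure.pi fun _ => (volume : Measure ℝ)) =
      c ^ n * ∫ x, maxKernelDet (jostWeight q (k / Complex.I)) (jostTail q (k / Complex.I)) 0 n x
        ∂(Measure.pi fun _ => (volume : Measure ℝ)) := by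
  set κ := k / Complex.I with hκdef
  have hκ : 0 < κ.re := div_I_re_pos hk
  set a : ℝ → ℝ → ℂ := fun η x => Complex.exp (-(2 * Real.pi * x * η * Complex.I)) with ha
  set b : ℝ → ℝ → ℂ := fun x η => c * (conj (q x) *
    ((κ + 2 * Real.pi * Complex.I * η)⁻¹ * resolventModulate κ q η x)) with hb
  have h1 : ∀ η η' : ℝ, inner ℂ (ContinuousLinearMap.adjoint (halfResolvent k hk (-1))
      (modulateSchwartz q η)) ((c * halfSymbol k 1 η' ^ 2) •
        halfResolvent k hk (-1) (modulateSchwartz q η')) = ∫ x, a η x * b x η' := by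
    intro η η'
    rw [inner_smul_right, inner_halfResolvent_modulate, ← integral_const_mul, halfSymbol_sq]
    refine integral_congr_ae (Eventually.of_forall fun x => ?_)
    simp only [ha, hb, ← hκdef]
    rw [show κ + ((1 : ℝ) : ℂ) * (2 * Real.pi * Complex.I * η') =
      κ + 2 * Real.pi * Complex.I * η' by push_cast; ring]
    ring
  have h2 : ∀ x x' : ℝ, ∫ η, b x η * a η x' = c * (Complex.exp (-(κ * x)) *
      (jostWeight q κ x * (jostTail q κ (max x x') - 0)) * Complex.exp (κ * x')) := by
    intro x x'
    have h3 := congrArg (fun z => c * conj (q x) * z) (integral_resolventModulate q hκ x x')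
    beta_reduce at h3
    rw [← integral_const_mul] at h3
    have h4 : ∫ η, b x η * a η x' = ∫ η : ℝ, c * conj (q x) *
        ((κ + 2 * Real.pi * Complex.I * η)⁻¹ * resolventModulate κ q η x *
        Complex.exp (-(2 * Real.pi * x' * η * Complex.I))) := by
      refine integral_congr_ae (Eventually.of_forall fun η => ?_)
      simp only [ha, hb]
      ring
    have h5 : Complex.exp (2 * κ * x) = Complex.exp (κ * x) * Complex.exp (κ * x) := by
      rw [← Complex.exp_add]
      congr 1
      ring
    have h6 : Complex.exp (-(κ * x)) * Complex.exp (κ * x) = 1 := by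
      rw [← Complex.exp_add]
      simp
    rw [h4, h3, jostWeight, h5]
    linear_combination (-c * conj (q x) * Complex.exp (κ * x) * jostTail q κ (max x x') *
      Complex.exp (κ * x')) * h6
  simp_rw [h1]
  rw [integral_det_kernel_comm n (μ := volume) (ν := volume) (a := a) (b := b)
    (α := fun η => ‖c‖ * byPartsConst q * (‖κ + 2 * Real.pi * Complex.I * η‖⁻¹ *
      ‖κ - 2 * Real.pi * Complex.I * η‖⁻¹)) (β := fun x => ‖q x‖)
    (by
      refine Continuous.measurable ?_
      simp only [ha, Function.uncurry_def]
      fun_prop)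
    (by
      have h3 := measurable_resolventModulate q κ
      have h4 := q.continuous.measurable
      have h5 : Measurable fun z : ℝ × ℝ => conj (q z.1) :=
        Complex.continuous_conj.measurable.comp (h4.comp measurable_fst)
      simp only [hb, Function.uncurry_def]
      exact measurable_const.mul (h5.mul (Measurable.mul (by fun_prop) h3)))
    (fun η x => by
      simp only [ha]
      rw [← conj_cexp_modulation, RCLike.norm_conj, norm_cexp_modulation])
    ((integrable_inv_norm_mul_inv_norm hκ).const_mul _) q.integrable.norm
    (fun x η => by
      simp only [hb]
      rw [norm_mul, norm_mul, norm_mul, norm_inv, RCLike.norm_conj]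
      have h3 := norm_resolventModulate_le q hκ η x
      calc _ ≤ ‖c‖ * (‖q x‖ * (‖κ + 2 * Real.pi * Complex.I * η‖⁻¹ *
            (byPartsConst q * ‖κ - 2 * Real.pi * Complex.I * η‖⁻¹))) := by gcongr
        _ = _ := by ring)]
  simp_rw [h2]
  rw [← integral_const_mul]
  refine integral_congr_ae (Eventually.of_forall fun x => ?_)
  simp only
  have e1 := Matrix.det_smul (Matrix.of fun i j => Complex.exp (-(κ * x i)) *
      (jostWeight q κ (x i) * (jostTail q κ (max (x i) (x j)) - 0)) * Complex.exp (κ * x j)) c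
  have e2 := Matrix.det_mul_row (fun j => Complex.exp (κ * x j)) (Matrix.of fun i j =>
    Complex.exp (-(κ * x i)) * (jostWeight q κ (x i) * (jostTail q κ (max (x i) (x j)) - 0)))
  have e3 := Matrix.det_mul_column (fun i => Complex.exp (-(κ * x i))) (Matrix.of fun i j =>
    jostWeight q κ (x i) * (jostTail q κ (max (x i) (x j)) - 0))
  have e4 : (∏ j, Complex.exp (κ * x j)) * ∏ j, Complex.exp (-(κ * x j)) = 1 := by
    rw [← Finset.prod_mul_distrib]
    refine Finset.prod_eq_one fun j _ => ?_
    rw [← Complex.exp_add]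
    simp
  simp only [Matrix.of_apply] at e2 e3
  rw [Fintype.card_fin] at e1
  have e5 : (Matrix.of fun i j => c * (Complex.exp (-(κ * x i)) *
      (jostWeight q κ (x i) * (jostTail q κ (max (x i) (x j)) - 0)) * Complex.exp (κ * x j))) =
      c • (Matrix.of fun i j => Complex.exp (-(κ * x i)) *
      (jostWeight q κ (x i) * (jostTail q κ (max (x i) (x j)) - 0)) * Complex.exp (κ * x j)) := by
    ext i j
    simp
  have e6 : (Matrix.of fun i j => Complex.exp (-(κ * x i)) *
      (jostWeight q κ (x i) * (jostTail q κ (max (x i) (x j)) - 0)) * Complex.exp (κ * x j)) =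
      Matrix.of fun i j => Complex.exp (κ * x j) * (Complex.exp (-(κ * x i)) *
      (jostWeight q κ (x i) * (jostTail q κ (max (x i) (x j)) - 0))) := by
    ext i j
    simp only [Matrix.of_apply]
    ring
  rw [e5, e1, e6, e2, e3, ← mul_assoc (∏ j, Complex.exp (κ * x j)), e4, one_mul]
  rfl

end Kernel

/-! ### The determinant and the scattering coefficient -/

theorem lemma3p2 (q : 𝓢(ℝ, ℂ)) (k : ℂ) (hk : 0 < k.im) :
    ∃ a : ℂ, HasFredholmDet (-(k • (LambdaOp k hk q ∘L GammaOp k hk q))) a ∧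
      HasScatteringCoeff (Complex.sqrt k) q a := by
  set κ := k / Complex.I with hκdef
  have hκ : 0 < κ.re := div_I_re_pos hk
  have hsqrt : Complex.sqrt k ^ 2 = k := by
    rw [Complex.sqrt, ← Complex.cpow_nat_mul]
    norm_num
  refine ⟨_, ?_, hasScatteringCoeff_of_im_pos q hk hsqrt⟩
  have hdet := hasFredholmDet_smul_LambdaOp_comp_GammaOp hk q (-k)
  rw [neg_smul] at hdet
  simp_rw [integral_det_frequency_eq hk q (-k)] at hdet
  have hw := (continuous_jostWeight q (κ := κ)).measurable
  have hH := (continuous_jostTail q hκ).measurable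
  have h0 := (hasSum_scatteringCoeff q k hκ).mul_left (-k)
  -- The terms of the Fredholm series; from `n = 1` on they are `-k` times those of the Neumann
  -- series.
  set F : ℕ → ℂ := fun n => (n.factorial : ℂ)⁻¹ * ((-k) ^ n *
    ∫ x, maxKernelDet (jostWeight q κ) (jostTail q κ) 0 n x
      ∂(Measure.pi fun _ => (volume : Measure ℝ))) with hF
  have hF1 : (fun n => F (n + 1)) = fun n => -k * ((-k) ^ n * ∫ x, jostWeight q κ x *
      jostTail q κ x * orderedIntegral (jostWeight q κ) (jostTail q κ) n x) := by
    ext n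
    rw [← integral_maxKernelDet_univ hw hH (q.integrable.norm.const_mul (normL1 q))
      (fun x y t hxy hyt => norm_weight_mul_tail_sub_le q hκ hxy hyt)
      (fun x y hxy => norm_weight_mul_tail_le q hκ hxy) n]
    simp only [hF]
    rw [pow_succ]
    ring
  have hF0 : F 0 = 1 := by
    simp [hF, maxKernelDet, Measure.real]
  have hs := (hasSum_nat_add_iff 1).1 (hF1 ▸ h0)
  rw [Finset.sum_range_one, hF0] at hs
  rw [hs.tsum_eq] at hdet
  convert hdet using 1
  ring

end
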